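/- Work in $\mathbb{R}^3$ with units $\epsilon_0=\mu_0=1$ at a frequency $\omega>0$. For a bounded measurable matrix field $\epsilon(\mathbf r)$ and a square-integrable current $\mathbf j$ of bounded support, the outgoing field of $\mathbf j$ is the solution $\mathbf e$ of $(\nabla\times\nabla\times-\omega^2\epsilon)\mathbf e=i\omega\,\mathbf j$ selected by limiting absorption, i.e. $\mathbf e=\lim_{\eta\downarrow0}\mathbf e_\eta$ in $L^2_{\mathrm{loc}}$, where $\mathbf e_\eta\in H(\mathrm{curl};\mathbb{R}^3)$ is the weak solution of $(\nabla\times\nabla\times-\omega^2\epsilon-i\eta)\mathbf e_\eta=i\omega\,\mathbf j$. The Green's function $\mathbb{G}$ of $\epsilon$ consists of the bounded operators $\mathbb{G}_{BA}:L^2(A;\mathbb{C}^3)\to L^2(B;\mathbb{C}^3)$ ($A,B$ bounded measurable) such that the outgoing field of each $\mathbf j\in L^2(A;\mathbb C^3)$ has restriction $\frac{i}{\omega}\mathbb{G}_{BA}\,\mathbf j$ to $B$. Let $S$ (sender), $R$ (receiver), $D$ (design region) be bounded measurable sets, which may overlap, let $(D_k)_k$ be any family of measurable subsets of $D$ with indicator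 multiplication operators $\mathbb{I}_k$, and let $\alpha,P,N>0$ and $\chi\in\mathbb{C}\setminus\{0\}$. A photonic structure is a permittivity $\epsilon(\mathbf r)=\mathbb{I}+\chi P_\epsilon(\mathbf r)$, where $P_\epsilon$ is a measurable field of orthogonal projections of $\mathbb{C}^3$ vanishing outside $D$. Let $\mathbb{G}_0$ be the Green's function of vacuum ($\epsilon=\mathbb{I}$) and let $\mathbb{G}_t$ be the Green's function of the structure. The Shannon capacity $C(\epsilon,P)$ is the supremum, over all laws of a random current $\mathbf j_i\in L^2(S;\mathbb{C}^3)$ with $\mathbb{E}|\mathbf j_i|^2<\infty$ and $$\mathbb{E}\Big[-\tfrac12\,\mathrm{Re}\Big\{\tfrac{i}{\omega}\,\mathbf j_i^\dagger\mathbb{G}_{t,SS}\,\mathbf j_i\Big\}\Big]+\mathbb{E}\big[\alpha|\mathbf j_i|^2\big]\le P,$$ of the mutual information $\mathcal I(\mathbf j_i;\mathbf e_R)=\mathcal H(\mathbf e_R)-\mathcal H(\mathbf e_R|\mathbf j_i)$ (in bits) of the channel $\mathbf e_R=\frac{i}{\omega}\mathbb{G}_{t,RS}\,\mathbf j_i+\mathbf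 n$, where $\mathbf n$ is independent circular complex Gaussian white noise on $R$ of covariance $N\,\mathbb{I}$. Here $\mathcal H$ is differential entropy, and the mutual information with the received field is the supremum of that with its components along finite orthonormal systems of $L^2(R;\mathbb{C}^3)$. Write $\mathrm{Asym}\,A=\frac1{2i}(A-A^\dagger)$ and $\mathbb{U}=\chi^{-\dagger}\mathbb{I}-\mathbb{G}_{0,DD}^\dagger$. Then, for every photonic structure $\epsilon$ that has a Green's function $\mathbb G_t$, $C(\epsilon,P)$ is at most the optimum (supremum, possibly $+\infty$) of the program $$\sup_{\mathbb{J}}\ \log_2\det\Big(\mathbb{I}+\frac{P}{N\omega^2}\begin{bmatrix}\mathbb{G}_{0,RS}&\mathbb{G}_{0,RD}\end{bmatrix}\mathbb{J}\begin{bmatrix}\mathbb{G}_{0,RS}^\dagger\\ \mathbb{G}_{0,RD}^\dagger\end{bmatrix}\Big)$$ over positive semidefinite trace-class operators $\mathbb{J}$ on $L^2(S;\mathbb{C}^3)\oplus L^2(D;\mathbb{C}^3)$ subject to $$\mathrm{Tr}\left(\begin{bmatrix}\alpha\mathbb{I}_S+\frac1{2\omega}\mathrm{Asym}\,\mathbb{G}_{0,SS}&\frac1{2\omega}\frac1{2i}\mathbb{G}_{0,SD}\\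 \frac1{2\omega}\frac{-1}{2i}\mathbb{G}_{0,SD}^\dagger&0\end{bmatrix}\mathbb{J}\right)\le1,\qquad \mathrm{Tr}\left(P\begin{bmatrix}0&-\mathbb{G}_{0,DS}^\dagger\mathbb{I}_k\\0&\mathbb{U}\,\mathbb{I}_k\end{bmatrix}\mathbb{J}\right)=0\quad\text{for all }k.$$ The determinant is the Fredholm determinant. The program does not depend on the structure. -/

import Mathlib

open MeasureTheory Filter Topology
open scoped InnerProductSpace ENNReal

noncomputable section

/-! ## Fields and currents -/

/-- Physical space. -/
abbrev Space3 : Type := EuclideanSpace ℝ (Fin 3)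

/-- Complex vector amplitudes of time-harmonic fields and currents. -/
abbrev Amplitude : Type := EuclideanSpace ℂ (Fin 3)

/-- Square-integrable vector fields (currents, polarizations, electric fields) on a region `A`. -/
abbrev FieldSpace (A : Set Space3) : Type :=
  Lp Amplitude 2 ((volume : Measure Space3).restrict A)

/-- Random fields are described by Borel measures on the field space. -/
instance FieldSpace.instMeasurableSpace (A : Set Space3) : MeasurableSpace (FieldSpace A) :=
  borel _

instance FieldSpace.instBorelSpace (A : Set Space3) : BorelSpace (FieldSpace A) := ⟨rfl⟩

/-- The product of a field over `A` with the indicator function of `B`. -/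
def regionMul (A B : Set Space3) (hB : MeasurableSet B) (f : FieldSpace A) : FieldSpace A :=
  MemLp.toLp (B.indicator (f : Space3 → Amplitude)) ((Lp.memLp f).indicator hB)

theorem regionMul_coeFn (A B : Set Space3) (hB : MeasurableSet B) (f : FieldSpace A) :
    (regionMul A B hB f : Space3 → Amplitude)
      =ᵐ[(volume : Measure Space3).restrict A] B.indicator (f : Space3 → Amplitude) :=
  MemLp.coeFn_toLp _

theorem regionMul_add (A B : Set Space3) (hB : MeasurableSet B) (f g : FieldSpace A) :
    regionMul A B hB (f + g) = regionMul A B hB f + regionMul A B hB g := by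
  refine Lp.ext ?_
  filter_upwards [regionMul_coeFn A B hB (f + g), regionMul_coeFn A B hB f,
    regionMul_coeFn A B hB g, Lp.coeFn_add f g,
    Lp.coeFn_add (regionMul A B hB f) (regionMul A B hB g)] with x h1 h2 h3 h4 h5
  rw [h1, h5, Pi.add_apply, h2, h3]
  by_cases hx : x ∈ B
  · rw [Set.indicator_of_mem hx, Set.indicator_of_mem hx, Set.indicator_of_mem hx, h4,
      Pi.add_apply]
  · rw [Set.indicator_of_notMem hx, Set.indicator_of_notMem hx, Set.indicator_of_notMem hx,
      add_zero]

theorem regionMul_smul (A B : Set Space3) (hB : MeasurableSet B) (c : ℂ) (f : FieldSpace A) :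
    regionMul A B hB (c • f) = c • regionMul A B hB f := by
  refine Lp.ext ?_
  filter_upwards [regionMul_coeFn A B hB (c • f), regionMul_coeFn A B hB f,
    Lp.coeFn_smul c f, Lp.coeFn_smul c (regionMul A B hB f)] with x h1 h2 h3 h4
  rw [h1, h4, Pi.smul_apply, h2]
  by_cases hx : x ∈ B
  · rw [Set.indicator_of_mem hx, Set.indicator_of_mem hx, h3, Pi.smul_apply]
  · rw [Set.indicator_of_notMem hx, Set.indicator_of_notMem hx, smul_zero]

theorem regionMul_norm_le (A B : Set Space3) (hB : MeasurableSet B) (f : FieldSpace A) :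
    ‖regionMul A B hB f‖ ≤ 1 * ‖f‖ := by
  rw [one_mul]
  refine Lp.norm_le_norm_of_ae_le ?_
  filter_upwards [regionMul_coeFn A B hB f] with x hx
  rw [hx]
  exact norm_indicator_le_norm_self _ _

/-- The operator `𝕀_B` of multiplication by the indicator function of the sub-region `B`, on
fields over `A`. -/
def regionProj (A B : Set Space3) (hB : MeasurableSet B) : FieldSpace A →L[ℂ] FieldSpace A :=
  LinearMap.mkContinuous
    { toFun := regionMul A B hB
      map_add' := regionMul_add A B hB
      map_smul' := regionMul_smul A B hB }
    1 (regionMul_norm_le A B hB)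

/-! ## Maxwell's equations and Green's functions -/

/-- `c` is the weak (distributional) curl of `u`: componentwise,
`∫ θ c = - ∫ (∇ θ) × u` for every real test function `θ`.  Indices are cyclic modulo 3. -/
def HasWeakCurl (u c : Space3 → Amplitude) : Prop :=
  ∀ θ : Space3 → ℝ, ContDiff ℝ (⊤ : ℕ∞) θ → HasCompactSupport θ → ∀ i : Fin 3,
    ∫ r, (θ r : ℂ) * c r i =
      - ∫ r, ((fderiv ℝ θ r (EuclideanSpace.single (i + 1) 1) : ℂ) * u r (i + 2)
            - (fderiv ℝ θ r (EuclideanSpace.single (i + 2) 1) : ℂ) * u r (i + 1))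

/-- `e` is the finite-energy weak solution, in `H(curl; ℝ³)`, of Maxwell's wave equation
`(∇×∇× - (ω² ε(r) + i η)) e = i ω j` with an additional uniform absorption `η`. -/
def IsLossySolution (ω η : ℝ) (ε : Space3 → Amplitude →L[ℂ] Amplitude)
    (j e : Space3 → Amplitude) : Prop :=
  MemLp e 2 volume ∧ ∃ c : Space3 → Amplitude, MemLp c 2 volume ∧ HasWeakCurl e c ∧
    ∀ φ ψ : Space3 → Amplitude, MemLp φ 2 volume → MemLp ψ 2 volume → HasWeakCurl φ ψ →
      (∫ r, ⟪ψ r, c r⟫_ℂ) -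
        (∫ r, ⟪φ r, ((ω : ℂ) ^ 2) • ε r (e r) + (Complex.I * (η : ℂ)) • e r⟫_ℂ)
        = ∫ r, ⟪φ r, (Complex.I * (ω : ℂ)) • j r⟫_ℂ

/-- `e` is the outgoing electric field radiated by the free current `j` in the medium with
permittivity `ε` at frequency `ω` (time dependence `exp (-iωt)`): it solves
`(∇×∇× - ω² ε(r)) e = i ω j`, the outgoing solution being selected by the limiting absorption
principle, i.e. as the limit, in `L²` on every ball, of the finite-energy fields in the medium
with vanishing uniform absorption. -/
def IsOutgoingField (ω : ℝ) (ε : Space3 → Amplitude →L[ℂ] Amplitude)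
    (j e : Space3 → Amplitude) : Prop :=
  AEStronglyMeasurable e volume ∧
  ∃ eη : ℝ → Space3 → Amplitude,
    (∀ η : ℝ, 0 < η → IsLossySolution ω η ε j (eη η)) ∧
    ∀ ρ : ℝ, Tendsto
      (fun η => eLpNorm (eη η - e) 2 ((volume : Measure Space3).restrict (Metric.ball 0 ρ)))
      (𝓝[>] 0) (𝓝 0)

/-- The permittivity of vacuum, in units with `ε₀ = μ₀ = 1`. -/
def vacuum : Space3 → Amplitude →L[ℂ] Amplitude := fun _ => 1

/-- A photonic structure in the design region `D`: a measurable field of orthogonal projections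
vanishing outside `D` (for an isotropic structure occupying `M ⊆ D`, the indicator of `M`). -/
structure PhotonicStructure (D : Set Space3) where
  proj : Space3 → Amplitude →L[ℂ] Amplitude
  measurable_proj : Measurable proj
  isStarProjection_proj : ∀ r, IsStarProjection (proj r)
  proj_eq_zero : ∀ r, r ∉ D → proj r = 0

/-- The permittivity `ε(r) = 𝕀 + P_ε(r) χ` of a structure made of a material of constant
susceptibility `χ`, placed in vacuum. -/
def PhotonicStructure.permittivity {D : Set Space3} (M : PhotonicStructure D) (χ : ℂ) :
    Space3 → Amplitude →L[ℂ] Amplitude :=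
  fun r => 1 + χ • M.proj r

/-- Families of bounded operators `G B A`, from currents on `A` to fields on `B`. -/
abbrev BlockOperators : Type :=
  ∀ B A : Set Space3, FieldSpace A →L[ℂ] FieldSpace B

/-- `G` is the Green's function of Maxwell's equations in the medium `ε` at frequency `ω`, given
through its sub-blocks `G B A` between bounded measurable regions: for every current `j` on `A`
the restriction to `B` of the outgoing field radiated by `j` is `(i/ω) G B A j`.
This determines `G B A` uniquely. -/
def IsGreenFunction (ω : ℝ) (ε : Space3 → Amplitude →L[ℂ] Amplitude) (G : BlockOperators) : Prop :=
  ∀ B A : Set Space3, MeasurableSet B → Bornology.IsBounded B →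
    MeasurableSet A → Bornology.IsBounded A →
    ∀ j : FieldSpace A, ∃ e : Space3 → Amplitude,
      IsOutgoingField ω ε (A.indicator (j : Space3 → Amplitude)) e ∧
      (fun r => (Complex.I / (ω : ℂ)) • (G B A j : Space3 → Amplitude) r)
        =ᵐ[(volume : Measure Space3).restrict B] e

/-! ## Mutual information and Shannon capacity -/

/-- Differential entropy, in bits, of a law on `ℂᵐ` with a density. -/
def diffEntropy {m : ℕ} (μ : Measure (Fin m → ℂ)) : ℝ :=
  ∫ y, (μ.rnDeriv volume y).toReal * Real.logb 2 (1 / (μ.rnDeriv volume y).toReal)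

/-- The zero-mean circularly symmetric complex Gaussian law on `ℂᵐ` with `E[n n†] = N I`. -/
def gaussianNoise (m : ℕ) (N : ℝ) : Measure (Fin m → ℂ) :=
  (volume : Measure (Fin m → ℂ)).withDensity fun z =>
    ENNReal.ofReal ((1 / (Real.pi * N)) ^ m * Real.exp (-(∑ k, ‖z k‖ ^ 2) / N))

/-- The law of `y = h x + n` where `x` has law `γ` and `n` is independent Gaussian noise. -/
def outputLaw {X : Type*} [MeasurableSpace X] {m : ℕ} (h : X → Fin m → ℂ) (N : ℝ)
    (γ : Measure X) : Measure (Fin m → ℂ) :=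
  (γ.prod (gaussianNoise m N)).map fun p => h p.1 + p.2

/-- The conditional law of `y = h x + n` given `x`. -/
def condOutputLaw {X : Type*} {m : ℕ} (h : X → Fin m → ℂ) (N : ℝ) (x : X) :
    Measure (Fin m → ℂ) :=
  (gaussianNoise m N).map fun n => h x + n

/-- The mutual information `I(x; y) = H(y) - H(y|x)`, in bits, of the channel `y = h x + n`
with finitely many complex outputs, for the input law `γ`. -/
def mutualInfo {X : Type*} [MeasurableSpace X] {m : ℕ} (h : X → Fin m → ℂ) (N : ℝ)
    (γ : Measure X) : ℝ :=
  diffEntropy (outputLaw h N γ) - ∫ x, diffEntropy (condOutputLaw h N x) ∂γ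

/-- The mutual information between the input `x`, of law `γ`, and the received field `H x + n`,
where `n` is complex Gaussian white noise of covariance `N · 𝕀` on the Hilbert space `Y`.
White noise is a generalized random field: for an orthonormal system `u` the noise components
`⟪u k, n⟫` are independent circular complex Gaussians of variance `N`.  The information carried
by the whole field is the supremum of that carried by finitely many components. -/
def fieldMutualInfo {X Y : Type*} [MeasurableSpace X] [NormedAddCommGroup Y]
    [InnerProductSpace ℂ Y] (H : X → Y) (N : ℝ) (γ : Measure X) : EReal :=
  ⨆ (m : ℕ) (u : Fin m → Y) (_ : Orthonormal ℂ u),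
    ((mutualInfo (fun x k => ⟪u k, H x⟫_ℂ) N γ : ℝ) : EReal)

/-- Expected drive power: extracted power plus insertion cost. -/
def expectedDrivePower {S : Set Space3} (ω α : ℝ) (GSS : FieldSpace S →L[ℂ] FieldSpace S)
    (γ : Measure (FieldSpace S)) : ℝ :=
  (∫ j, -(1 / 2) * ((Complex.I / (ω : ℂ)) * ⟪j, GSS j⟫_ℂ).re ∂γ) + ∫ j, α * ‖j‖ ^ 2 ∂γ

/-- The Shannon capacity from the sender region `S` to the receiver region `R` in a medium with
Green's function `G`, under the drive-power budget `P`: the supremum of the mutual information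
between the input current `j` and the received field `(i/ω) G_RS j + n` over all laws of `j`
with finite second moment that respect the budget. -/
def shannonCapacity (S R : Set Space3) (ω α P N : ℝ) (G : BlockOperators) : EReal :=
  ⨆ (γ : Measure (FieldSpace S)) (_ : IsProbabilityMeasure γ)
    (_ : Integrable (fun j => ‖j‖ ^ 2) γ) (_ : expectedDrivePower ω α (G S S) γ ≤ P),
    fieldMutualInfo (fun j => (Complex.I / (ω : ℂ)) • G R S j) N γ

/-! ## Traces, log-determinants and block operators -/

/-- `t` is the trace of `T`: `∑ ⟪b i, T (b i)⟫ = t`, with unconditional convergence, in every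
Hilbert basis. For a positive operator, having a trace means being trace class. -/
def HasTrace {H : Type} [NormedAddCommGroup H] [InnerProductSpace ℂ H]
    (T : H →L[ℂ] H) (t : ℂ) : Prop :=
  ∀ (ι : Type) (b : HilbertBasis ι ℂ H), HasSum (fun i => ⟪b i, T (b i)⟫_ℂ) t

/-- `log₂ det (𝕀 + T)` for a positive trace-class operator `T`: the Fredholm determinant is the
supremum of the determinants of the compressions of `𝕀 + T` to finite-dimensional subspaces. -/
def logDetOneAdd {H : Type*} [NormedAddCommGroup H] [InnerProductSpace ℂ H]
    (T : H →L[ℂ] H) : EReal :=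
  ⨆ (m : ℕ) (u : Fin m → H) (_ : Orthonormal ℂ u),
    ((Real.logb 2
      (1 + Matrix.of fun a b : Fin m => ⟪u a, T (u b)⟫_ℂ : Matrix (Fin m) (Fin m) ℂ).det.re : ℝ)
      : EReal)

/-- `Asym A = (A - A†) / (2i)`. -/
def asym {H : Type*} [NormedAddCommGroup H] [InnerProductSpace ℂ H] [CompleteSpace H]
    (A : H →L[ℂ] H) : H →L[ℂ] H :=
  (1 / (2 * Complex.I)) • (A - ContinuousLinearMap.adjoint A)

section Blocks

variable {E F K : Type*} [NormedAddCommGroup E] [InnerProductSpace ℂ E]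
  [NormedAddCommGroup F] [InnerProductSpace ℂ F] [NormedAddCommGroup K] [InnerProductSpace ℂ K]

/-- The block row operator `[a b]` on the Hilbert direct sum `E ⊕ F`. -/
def rowOp (a : E →L[ℂ] K) (b : F →L[ℂ] K) : WithLp 2 (E × F) →L[ℂ] K :=
  (a.coprod b).comp (WithLp.prodContinuousLinearEquiv 2 ℂ E F : WithLp 2 (E × F) →L[ℂ] E × F)

/-- The block operator `[[a, b], [c, d]]` on the Hilbert direct sum `E ⊕ F`. -/
def blockOp (a : E →L[ℂ] E) (b : F →L[ℂ] E) (c : E →L[ℂ] F) (d : F →L[ℂ] F) :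
    WithLp 2 (E × F) →L[ℂ] WithLp 2 (E × F) :=
  ((WithLp.prodContinuousLinearEquiv 2 ℂ E F).symm : E × F →L[ℂ] WithLp 2 (E × F)).comp
    ((rowOp a b).prod (rowOp c d))

end Blocks

/-! ## The structure-agnostic convex program -/

/-- Joint source/polarization currents: the Hilbert direct sum `L²(S) ⊕ L²(D)`. -/
abbrev JointSpace (S D : Set Space3) : Type := WithLp 2 (FieldSpace S × FieldSpace D)

/-- `𝕌 = χ^{-†} 𝕀 - G_DD†`. -/
def opU {D : Set Space3} (χ : ℂ) (GDD : FieldSpace D →L[ℂ] FieldSpace D) :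
    FieldSpace D →L[ℂ] FieldSpace D :=
  (starRingEnd ℂ χ⁻¹) • (1 : FieldSpace D →L[ℂ] FieldSpace D) - ContinuousLinearMap.adjoint GDD

/-- The block operator of the drive-power constraint. -/
def drivePowerOp (S D : Set Space3) (ω α : ℝ) (G₀ : BlockOperators) :
    JointSpace S D →L[ℂ] JointSpace S D :=
  blockOp
    ((α : ℂ) • (1 : FieldSpace S →L[ℂ] FieldSpace S) + (1 / (2 * (ω : ℂ))) • asym (G₀ S S))
    ((1 / (2 * (ω : ℂ)) * (1 / (2 * Complex.I))) • G₀ S D)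
    ((1 / (2 * (ω : ℂ)) * (-1 / (2 * Complex.I))) • ContinuousLinearMap.adjoint (G₀ S D))
    0

/-- The block operator of the energy-conservation constraint on the sub-region `B` of `D`. -/
def energyOp (S D : Set Space3) (P : ℝ) (χ : ℂ) (G₀ : BlockOperators) (B : Set Space3)
    (hB : MeasurableSet B) : JointSpace S D →L[ℂ] JointSpace S D :=
  (P : ℂ) • blockOp
    0 (-((ContinuousLinearMap.adjoint (G₀ D S)).comp (regionProj D B hB)))
    0 ((opU χ (G₀ D D)).comp (regionProj D B hB))

/-- Feasible points of the convex program: positive semidefinite trace-class operators `J` that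
satisfy the drive-power and the energy-conservation trace constraints. -/
structure IsFeasible (S D : Set Space3) (ω α P : ℝ) (χ : ℂ) (G₀ : BlockOperators)
    {κ : Type*} (Dk : κ → Set Space3) (hDk : ∀ k, MeasurableSet (Dk k))
    (J : JointSpace S D →L[ℂ] JointSpace S D) : Prop where
  isPositive : J.IsPositive
  traceClass : ∃ t : ℂ, HasTrace J t
  drivePower : ∃ t : ℝ, HasTrace ((drivePowerOp S D ω α G₀).comp J) (t : ℂ) ∧ t ≤ 1
  energy : ∀ k, HasTrace ((energyOp S D P χ G₀ (Dk k) (hDk k)).comp J) 0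

/-- The optimum (supremum) of the convex log-det program. -/
def convexBound (S R D : Set Space3) (ω α P N : ℝ) (χ : ℂ) (G₀ : BlockOperators)
    {κ : Type*} (Dk : κ → Set Space3) (hDk : ∀ k, MeasurableSet (Dk k)) : EReal :=
  ⨆ (J : JointSpace S D →L[ℂ] JointSpace S D) (_ : IsFeasible S D ω α P χ G₀ Dk hDk J),
    logDetOneAdd (((P / (N * ω ^ 2) : ℝ) : ℂ) •
      ((rowOp (G₀ R S) (G₀ R D)).comp
        (J.comp (ContinuousLinearMap.adjoint (rowOp (G₀ R S) (G₀ R D))))))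

end

/-! The bound is a relaxation: every admissible input law in a given structure produces a feasible
point of the program whose objective dominates the mutual information.

Let T = χ P_ε G_t,DS map the free current to the polarization current it induces. The total field is
the vacuum field of both currents, G_t,BS = G_0,BS + G_0,BD T for B = S, D, R
(`PhotonicStructure.greenFunction_eq`). For an input law γ put φ = P^(-1/2) (j, T j) and J = E[φ
φ†]. Since Tr(A J) = E⟪φ, A φ⟫ (`hasTrace_comp_secondMoment`), the drive-power trace is the expected
drive power divided by P. The energy traces vanish because P_ε e - e is orthogonal to P_ε e at every
point, hence also after restriction to any D_k (`isFeasible_secondMoment`). The row operator sends φ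
to P^(-1/2) G_t,RS j, so in a finite orthonormal system the operator inside the determinant has as
matrix 1/N times the second moments of the noiseless outputs (`inner_output_secondMoment`). Gibbs'
inequality against a Gaussian with the second moments of the noisy output then bounds the mutual
information by that log-determinant (`mutualInfo_le`).

The analytic work lies in `greenFunction_eq`. A Green's function supplies lossy fields and their
limits separately for each pair of regions, so fields observed on D and on B must first be
identified. This needs uniqueness in the medium, where χ is arbitrary and the vacuum energy estimate
fails. `IsLossyWeak.unique_medium` obtains it by continuation in the absorption, starting from large
absorption. `IsLossyWeak.tendsto_medium` then passes to the limit by uniform boundedness of the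
vacuum resolvents. -/

noncomputable section

/-! ## Lossy weak solutions in an abstract Hilbert space -/

section AbstractMaxwell

variable {H V K : Type*} [NormedAddCommGroup H] [InnerProductSpace ℂ H]
  [NormedAddCommGroup V] [InnerProductSpace ℂ V]
  [NormedAddCommGroup K] [NormedSpace ℂ K]

/-- The weak form of `(∇×∇× - (ω² E + i η)) e = i ω s`, where the subspace `W` of `H × H` is the
graph of the curl. -/
def IsLossyWeak (W : Submodule ℂ (H × H)) (ω η : ℝ) (E : H →L[ℂ] H) (s e : H) : Prop :=
  ∃ c : H, (e, c) ∈ W ∧ ∀ p ∈ W,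
    ⟪p.2, c⟫_ℂ - ⟪p.1, ((ω : ℂ) ^ 2) • E e + (Complex.I * (η : ℂ)) • e⟫_ℂ
      = ⟪p.1, (Complex.I * (ω : ℂ)) • s⟫_ℂ

variable {W : Submodule ℂ (H × H)} {ω η η' : ℝ} {E : H →L[ℂ] H} {s s' e e' : H}

namespace IsLossyWeak

theorem add (h : IsLossyWeak W ω η E s e) (h' : IsLossyWeak W ω η E s' e') :
    IsLossyWeak W ω η E (s + s') (e + e') := by
  obtain ⟨c, hc, h⟩ := h
  obtain ⟨c', hc', h'⟩ := h'
  refine ⟨c + c', W.add_mem hc hc', fun p hp => ?_⟩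
  have h1 := h p hp
  have h2 := h' p hp
  simp only [inner_add_right, smul_add, map_add] at h1 h2 ⊢
  linear_combination h1 + h2

theorem smul (a : ℂ) (h : IsLossyWeak W ω η E s e) :
    IsLossyWeak W ω η E (a • s) (a • e) := by
  obtain ⟨c, hc, h⟩ := h
  refine ⟨a • c, W.smul_mem a hc, fun p hp => ?_⟩
  have h1 := h p hp
  simp only [inner_add_right, inner_smul_right, map_smul] at h1 ⊢
  linear_combination a * h1

theorem sub (h : IsLossyWeak W ω η E s e) (h' : IsLossyWeak W ω η E s' e') :
    IsLossyWeak W ω η E (s - s') (e - e') := by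
  simpa [sub_eq_add_neg] using h.add (h'.smul (-1))

/-- The energy estimate in vacuum. -/
theorem norm_le (hω : 0 < ω) (hη : 0 < η) (h : IsLossyWeak W ω η 1 s e) :
    ‖e‖ ≤ ω / η * ‖s‖ := by
  obtain ⟨c, hc, h⟩ := h
  -- Tested with the solution itself, the curl term and the ω² term are real; the imaginary part
  -- keeps only the absorption and the source.
  have h1 := congrArg Complex.im (h (e, c) hc)
  simp only [one_apply_eq_self, inner_add_right, inner_smul_right] at h1
  rw [inner_self_eq_norm_sq_to_K, inner_self_eq_norm_sq_to_K] at h1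
  simp only [Complex.coe_algebraMap, ← Complex.ofReal_pow, Complex.sub_im, Complex.add_im,
    Complex.mul_im, Complex.ofReal_re, Complex.ofReal_im, Complex.I_re, Complex.I_im,
    Complex.mul_re] at h1
  have h2 : η * ‖e‖ ^ 2 = - (ω * (⟪e, s⟫_ℂ).re) := by linarith
  have h3 : |(⟪e, s⟫_ℂ).re| ≤ ‖e‖ * ‖s‖ :=
    (Complex.abs_re_le_norm _).trans (norm_inner_le_norm e s)
  have h4 : η * ‖e‖ ^ 2 ≤ ω * (‖e‖ * ‖s‖) := by
    rw [h2]
    have := (abs_le.1 h3).1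
    nlinarith
  rcases (norm_nonneg e).eq_or_lt with h0 | h0
  · rw [← h0]; positivity
  · rw [div_mul_eq_mul_div, le_div_iff₀ hη]
    nlinarith

theorem unique_vacuum (hω : 0 < ω) (hη : 0 < η) (h : IsLossyWeak W ω η 1 s e)
    (h' : IsLossyWeak W ω η 1 s e') : e = e' := by
  have := (h.sub h').norm_le hω hη
  rw [sub_self, norm_zero, mul_zero] at this
  exact sub_eq_zero.1 (norm_le_zero_iff.1 this)

/-- The polarization current turns a solution in a medium into a solution in vacuum. -/
theorem to_vacuum {χ : ℂ} {T : H →L[ℂ] H} (h : IsLossyWeak W ω η (1 + χ • T) s e) :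
    IsLossyWeak W ω η 1 (s - (Complex.I * ω * χ) • T e) e := by
  obtain ⟨c, hc, h⟩ := h
  refine ⟨c, hc, fun p hp => ?_⟩
  have h1 := h p hp
  simp only [add_apply, smul_apply,
    one_apply_eq_self, smul_add, inner_add_right, inner_sub_right, smul_sub,
    inner_smul_right] at h1 ⊢
  -- The source -iωχ T e enters multiplied by iω, which gives exactly the term ω²χ T e moved from
  -- the left side.
  linear_combination h1 + (ω : ℂ) ^ 2 * χ * ⟪p.1, T e⟫_ℂ * Complex.I_sq

/-- A change of the absorption is compensated by a change of the source. -/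
theorem change_absorption (hω : 0 < ω) (h : IsLossyWeak W ω η E s e) :
    IsLossyWeak W ω η' E (s + (((η - η') / ω : ℝ) : ℂ) • e) e := by
  obtain ⟨c, hc, h⟩ := h
  refine ⟨c, hc, fun p hp => ?_⟩
  have h1 := h p hp
  have hω' : (ω : ℂ) ≠ 0 := by exact_mod_cast hω.ne'
  simp only [smul_add, inner_add_right, inner_smul_right] at h1 ⊢
  push_cast
  field_simp
  linear_combination h1

end IsLossyWeak

/-- Where all sources radiate, the vacuum solution depends linearly and boundedly on the source. -/
theorem exists_vacuumResolvent (hω : 0 < ω) (hη : 0 < η) (ι : V →L[ℂ] H)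
    (h : ∀ v, ∃ e, IsLossyWeak W ω η 1 (ι v) e) :
    ∃ R : V →L[ℂ] H, (∀ v, IsLossyWeak W ω η 1 (ι v) (R v)) ∧ ‖R‖ ≤ ω / η * ‖ι‖ := by
  choose r hr using h
  -- The solutions are chosen arbitrarily; their linear dependence on the source is forced by
  -- uniqueness.
  let R : V →ₗ[ℂ] H :=
    { toFun := r
      map_add' := fun v w => (hr (v + w)).unique_vacuum hω hη
        (by rw [map_add]; exact (hr v).add (hr w))
      map_smul' := fun a v => (hr (a • v)).unique_vacuum hω hη
        (by rw [map_smul]; exact (hr v).smul a) }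
  have hb : ∀ v, ‖R v‖ ≤ ω / η * ‖ι‖ * ‖v‖ := fun v =>
    ((hr v).norm_le hω hη).trans (by
      rw [mul_assoc]
      exact mul_le_mul_of_nonneg_left (ι.le_opNorm v) (by positivity))
  exact ⟨R.mkContinuous _ hb, hr, R.mkContinuous_norm_le (by positivity) hb⟩

/-- A surjective operator on a Hilbert space which is a limit of invertible operators is
invertible. -/
theorem isUnit_of_surjective_of_mem_closure [CompleteSpace V] {X : V →L[ℂ] V}
    (hX : Function.Surjective X) (hc : X ∈ closure {Y : V →L[ℂ] V | IsUnit Y}) : IsUnit X := by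
  -- A surjective X is bijective on the orthogonal complement of its kernel, and the open mapping
  -- theorem makes the inverse there a bounded right inverse.
  obtain ⟨B, hB⟩ : ∃ B : V →L[ℂ] V, X * B = 1 := by
    let k : Submodule ℂ V := (LinearMap.ker (X : V →ₗ[ℂ] V))
    have : CompleteSpace k := (ContinuousLinearMap.isClosed_ker X).completeSpace_coe
    have hinj : LinearMap.ker (X.comp kᗮ.subtypeL : kᗮ →ₗ[ℂ] V) = ⊥ := by
      refine LinearMap.ker_eq_bot'.2 fun x hx => ?_
      have h1 : (x : V) ∈ k := hx
      have h2 := Submodule.inner_right_of_mem_orthogonal h1 x.2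
      exact Subtype.ext (inner_self_eq_zero.1 h2)
    have hsurj : LinearMap.range (X.comp kᗮ.subtypeL : kᗮ →ₗ[ℂ] V) = ⊤ := by
      refine LinearMap.range_eq_top.2 fun y => ?_
      obtain ⟨x, rfl⟩ := hX y
      obtain ⟨a, ha, b, hb, rfl⟩ := k.exists_add_mem_mem_orthogonal x
      refine ⟨⟨b, hb⟩, ?_⟩
      have : X a = 0 := ha
      simp [this]
    let eqv := ContinuousLinearEquiv.ofBijective (X.comp kᗮ.subtypeL) hinj hsurj
    refine ⟨kᗮ.subtypeL.comp (eqv.symm : V →L[ℂ] kᗮ), ?_⟩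
    ext y
    exact eqv.apply_symm_apply y
  -- Since X B = 1, an invertible Y close to X has Y B invertible. Then B = Y⁻¹ (Y B) is invertible,
  -- and X is its inverse.
  have hopen : IsOpen {Y : V →L[ℂ] V | IsUnit (Y * B)} :=
    Units.isOpen.preimage (continuous_id.mul continuous_const)
  obtain ⟨Y, hY1, hY2⟩ := mem_closure_iff.1 hc _ hopen (by simp [hB])
  obtain ⟨u, rfl⟩ := hY2
  have hBu : IsUnit B := by
    have h : IsUnit (((u⁻¹ : (V →L[ℂ] V)ˣ) : V →L[ℂ] V) * (u * B)) := (u⁻¹).isUnit.mul hY1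
    rwa [← mul_assoc, Units.inv_mul, one_mul] at h
  obtain ⟨b, rfl⟩ := hBu
  rw [Units.mul_eq_one_iff_eq_inv.1 hB]
  exact (b⁻¹).isUnit

/-- If vacuum and the medium `1 + χ Q` admit lossy solutions for all sources and all absorptions,
then the lossy solutions in the medium are unique. -/
theorem IsLossyWeak.unique_medium [CompleteSpace V] (hω : 0 < ω) (χ : ℂ)
    (ι : V →L[ℂ] H) (Q : H →L[ℂ] V)
    (hvac : ∀ η : ℝ, 0 < η → ∀ v, ∃ e, IsLossyWeak W ω η 1 (ι v) e)
    (hmed : ∀ η : ℝ, 0 < η → ∀ v, ∃ e, IsLossyWeak W ω η (1 + χ • ι.comp Q) (ι v) e)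
    (hη : 0 < η) (h : IsLossyWeak W ω η (1 + χ • ι.comp Q) s e)
    (h' : IsLossyWeak W ω η (1 + χ • ι.comp Q) s e') : e = e' := by
  choose R hR hRn using fun t : Set.Ioi (0 : ℝ) => exists_vacuumResolvent hω t.2 ι (hvac t t.2)
  -- A medium solution e with source ι v is the vacuum field R t f of the effective source f = v -
  -- iωχ Q e, and this f satisfies X t f = v. Uniqueness thus reduces to injectivity of X t.
  let X : Set.Ioi (0 : ℝ) → (V →L[ℂ] V) := fun t => 1 + (Complex.I * ω * χ) • Q.comp (R t)
  have hRcont : Continuous R := by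
    refine continuous_iff_continuousAt.2 fun t => ?_
    have hle : ∀ t' : Set.Ioi (0 : ℝ), ‖R t' - R t‖ ≤ |(t : ℝ) - t'| / t' * ‖R t‖ := by
      intro t'
      have ht' : (0 : ℝ) < t' := t'.2
      refine ContinuousLinearMap.opNorm_le_bound _ (by positivity) fun v => ?_
      -- A resolvent identity in disguise: both fields are viewed at absorption t', where their
      -- sources differ by a multiple of R t v of size |t - t'| / ω.
      have h1 := (((hR t v).change_absorption (η' := t') hω).sub (hR t' v)).norm_le hω ht'
      rw [add_sub_cancel_left, norm_smul, Complex.norm_real, Real.norm_eq_abs, abs_div,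
        abs_of_pos hω] at h1
      rw [sub_apply, norm_sub_rev]
      calc _ ≤ _ := h1
        _ = |(t : ℝ) - t'| / t' * ‖R t v‖ := by field_simp
        _ ≤ |(t : ℝ) - t'| / t' * (‖R t‖ * ‖v‖) := by
            gcongr
            exact (R t).le_opNorm v
        _ = _ := by ring
    rw [ContinuousAt, tendsto_iff_norm_sub_tendsto_zero]
    refine squeeze_zero (fun _ => norm_nonneg _) hle ?_
    have hc : ContinuousAt (fun t' : Set.Ioi (0 : ℝ) => |(t : ℝ) - t'| / t' * ‖R t‖) t := by
      have : ((t : Set.Ioi (0:ℝ)) : ℝ) ≠ 0 := (ne_of_gt t.2)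
      fun_prop (disch := assumption)
    simpa [ContinuousAt] using hc
  have hXcont : Continuous X := by
    have : Continuous fun t => Q.comp (R t) :=
      ((ContinuousLinearMap.compL ℂ V H V) Q).continuous.comp hRcont
    have h2 : Continuous fun t => (Complex.I * ω * χ) • Q.comp (R t) :=
      this.const_smul (Complex.I * ω * χ)
    exact continuous_const.add h2
  have hsol : ∀ (t : Set.Ioi (0 : ℝ)) (v : V) (e : H),
      IsLossyWeak W ω t (1 + χ • ι.comp Q) (ι v) e →
        e = R t (v - (Complex.I * ω * χ) • Q e) := by
    intro t v e he
    refine he.to_vacuum.unique_vacuum hω t.2 ?_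
    have := hR t (v - (Complex.I * ω * χ) • Q e)
    rwa [map_sub, map_smul] at this
  have hsurj : ∀ t, Function.Surjective (X t) := by
    intro t v
    obtain ⟨e, he⟩ := hmed t t.2 v
    refine ⟨v - (Complex.I * ω * χ) • Q e, ?_⟩
    change (v - (Complex.I * ω * χ) • Q e)
      + (Complex.I * ω * χ) • Q (R t (v - (Complex.I * ω * χ) • Q e)) = v
    rw [← hsol t v e he, sub_add_cancel]
  -- Continuation in the absorption: invertibility is open, and it is closed because existence in
  -- the medium makes every X t surjective. Connectedness of (0, ∞) spreads it from one value to
  -- all.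
  have hclopen : IsClopen {t | IsUnit (X t)} := by
    constructor
    · refine isClosed_of_closure_subset fun t ht => ?_
      refine isUnit_of_surjective_of_mem_closure (hsurj t) ?_
      exact closure_mono (Set.image_preimage_subset X {Y | IsUnit Y})
        (image_closure_subset_closure_image hXcont ⟨t, ht, rfl⟩)
    · exact Units.isOpen.preimage hXcont
  have : PreconnectedSpace (Set.Ioi (0 : ℝ)) :=
    Subtype.preconnectedSpace isPreconnected_Ioi
  have hne : {t | IsUnit (X t)}.Nonempty := by
    -- The perturbation of the identity at absorption t has norm at most b / t, so t = b + 1 puts X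
    -- t within reach of the Neumann series.
    let b : ℝ := ‖Complex.I * ω * χ‖ * (‖Q‖ * (ω * ‖ι‖))
    have hb : 0 ≤ b := by positivity
    refine ⟨⟨b + 1, by show 0 < b + 1; positivity⟩, ?_⟩
    have hlt : ‖(-((Complex.I * ω * χ) • Q.comp (R ⟨b + 1, by show 0 < b + 1; positivity⟩)))‖
        < 1 := by
      rw [norm_neg, norm_smul]
      calc _ ≤ ‖Complex.I * ω * χ‖ * (‖Q‖ * (ω / (b + 1) * ‖ι‖)) := by
            gcongr
            refine (ContinuousLinearMap.opNorm_comp_le _ _).trans ?_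
            gcongr
            exact hRn _
        _ = b / (b + 1) := by simp only [b]; ring
        _ < 1 := by rw [div_lt_one (by positivity)]; linarith
    cases subsingleton_or_nontrivial V with
    | inl hV =>
      refine isUnit_of_subsingleton _
    | inr hV =>
      have := isUnit_one_sub_of_norm_lt_one hlt
      rwa [sub_neg_eq_add] at this
  have hunit : ∀ t, IsUnit (X t) := fun t => by
    have : t ∈ {t | IsUnit (X t)} := by rw [hclopen.eq_univ hne]; exact Set.mem_univ t
    exact this
  -- The difference solves the equation without source; its effective source is killed by X, hence
  -- zero, and so is its field.
  have h0 : IsLossyWeak W ω η (1 + χ • ι.comp Q) (ι 0) (e - e') := by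
    rw [map_zero]; simpa using h.sub h'
  have h1 := hsol ⟨η, hη⟩ 0 _ h0
  have h2 : X ⟨η, hη⟩ (0 - (Complex.I * ω * χ) • Q (e - e')) = 0 := by
    change (0 - (Complex.I * ω * χ) • Q (e - e'))
      + (Complex.I * ω * χ) • Q (R ⟨η, hη⟩ (0 - (Complex.I * ω * χ) • Q (e - e'))) = 0
    rw [← h1, sub_add_cancel]
  have h3 : 0 - (Complex.I * ω * χ) • Q (e - e') = 0 := by
    obtain ⟨u, hu⟩ := hunit ⟨η, hη⟩
    rw [← hu] at h2
    have := congrArg ((u⁻¹ : (V →L[ℂ] V)ˣ) : V →L[ℂ] V) h2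
    rwa [← mul_apply_eq_comp, Units.inv_mul, map_zero] at this
  rw [h3, map_zero] at h1
  exact sub_eq_zero.1 h1

/-- Limiting absorption for the polarization equation: if the vacuum fields converge in `K` for
every source, then the fields in the medium converge to the vacuum field radiated by the source
and by the limit of the polarization currents. -/
theorem IsLossyWeak.tendsto_medium [CompleteSpace V] (hω : 0 < ω) (χ : ℂ)
    (ι : V →L[ℂ] H) (Q : H →L[ℂ] V) (ρ : H →L[ℂ] K) {t : ℕ → ℝ} (ht : ∀ n, 0 < t n)
    (hvac : ∀ n v, ∃ e, IsLossyWeak W ω (t n) 1 (ι v) e) (g : V → K)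
    (hg : ∀ (v : V) (e : ℕ → H), (∀ n, IsLossyWeak W ω (t n) 1 (ι v) (e n)) →
      Tendsto (fun n => ρ (e n)) atTop (𝓝 (g v)))
    {v q : V} {e : ℕ → H} (he : ∀ n, IsLossyWeak W ω (t n) (1 + χ • ι.comp Q) (ι v) (e n))
    (hq : Tendsto (fun n => Q (e n)) atTop (𝓝 q)) :
    Tendsto (fun n => ρ (e n)) atTop (𝓝 (g (v - (Complex.I * ω * χ) • q))) := by
  choose R hR hRn using fun n => exists_vacuumResolvent hω (ht n) ι (hvac n)
  have hlim : ∀ v, Tendsto (fun n => (ρ.comp (R n)) v) atTop (𝓝 (g v)) :=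
    fun v => hg v _ fun n => hR n v
  -- The operators ρ ∘ R n converge only pointwise while the effective source varies with n. A
  -- uniform bound allows the source to be replaced by its limit.
  obtain ⟨C, hC⟩ : ∃ C, ∀ n, ‖ρ.comp (R n)‖ ≤ C := by
    refine banach_steinhaus fun v => ?_
    obtain ⟨C, hC⟩ := (hlim v).norm.bddAbove_range
    exact ⟨C, fun n => hC ⟨n, rfl⟩⟩
  let f : ℕ → V := fun n => v - (Complex.I * ω * χ) • Q (e n)
  have hf : Tendsto f atTop (𝓝 (v - (Complex.I * ω * χ) • q)) :=
    tendsto_const_nhds.sub (hq.const_smul _)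
  have hef : ∀ n, e n = R n (f n) := fun n => by
    refine (he n).to_vacuum.unique_vacuum hω (ht n) ?_
    have := hR n (f n)
    rwa [map_sub, map_smul] at this
  have hdiff : Tendsto (fun n => (ρ.comp (R n)) (f n - (v - (Complex.I * ω * χ) • q)))
      atTop (𝓝 0) := by
    rw [tendsto_zero_iff_norm_tendsto_zero]
    refine squeeze_zero (fun _ => norm_nonneg _)
      (fun n => (ContinuousLinearMap.le_of_opNorm_le _ (hC n) _)) ?_
    have := (tendsto_iff_norm_sub_tendsto_zero.1 hf).const_mul C
    simpa using this
  have := hdiff.add (hlim (v - (Complex.I * ω * χ) • q))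
  rw [zero_add] at this
  refine this.congr fun n => ?_
  rw [map_sub, sub_add_cancel, hef n]
  rfl

end AbstractMaxwell

/-! ## Maxwell's equations as an abstract weak equation -/

/-- Square-integrable vector fields on the whole space. -/
abbrev GlobalField : Type := Lp Amplitude 2 (volume : Measure Space3)

namespace HasWeakCurl

variable {u u' c c' : Space3 → Amplitude}

theorem congr_ae (hu : u =ᵐ[volume] u') (hc : c =ᵐ[volume] c') (h : HasWeakCurl u c) :
    HasWeakCurl u' c' := by
  intro θ h1 h2 i
  have h3 : ∫ r, (θ r : ℂ) * c r i = ∫ r, (θ r : ℂ) * c' r i :=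
    integral_congr_ae (by filter_upwards [hc] with r hr; rw [hr])
  rw [← h3, h θ h1 h2 i]
  congr 1
  exact integral_congr_ae (by filter_upwards [hu] with r hr; rw [hr])

theorem integrable_coord_mul {θ : Space3 → ℝ} (hθ : Continuous θ) (hs : HasCompactSupport θ)
    (hu : MemLp u 2 volume) (i : Fin 3) : Integrable (fun r => (θ r : ℂ) * u r i) := by
  have h1 : MemLp (fun r => (θ r : ℂ)) 2 (volume : Measure Space3) :=
    (hθ.memLp_of_hasCompactSupport hs).ofReal
  have h2 : MemLp (fun r => u r i) 2 (volume : Measure Space3) :=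
    (EuclideanSpace.proj (𝕜 := ℂ) i : Amplitude →L[ℂ] ℂ).comp_memLp' hu
  exact h1.integrable_mul h2

theorem integrable_curl {θ : Space3 → ℝ} (hθ : ContDiff ℝ (⊤ : ℕ∞) θ) (hs : HasCompactSupport θ)
    (hu : MemLp u 2 volume) (i : Fin 3) :
    Integrable (fun r => (fderiv ℝ θ r (EuclideanSpace.single (i + 1) 1) : ℂ) * u r (i + 2)
      - (fderiv ℝ θ r (EuclideanSpace.single (i + 2) 1) : ℂ) * u r (i + 1)) := by
  have hc : ∀ v, Continuous fun r => fderiv ℝ θ r v := fun v =>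
    (hθ.continuous_fderiv (by simp)).clm_apply continuous_const
  have hs' : ∀ v, HasCompactSupport fun r => fderiv ℝ θ r v := fun v =>
    (hs.fderiv ℝ).comp_left (g := fun f : Space3 →L[ℝ] ℝ => f v) (by simp)
  exact (integrable_coord_mul (hc _) (hs' _) hu _).sub
    (integrable_coord_mul (hc _) (hs' _) hu _)

theorem add (hu : MemLp u 2 volume) (hu' : MemLp u' 2 volume) (hc : MemLp c 2 volume)
    (hc' : MemLp c' 2 volume) (h : HasWeakCurl u c) (h' : HasWeakCurl u' c') :
    HasWeakCurl (u + u') (c + c') := by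
  intro θ h1 h2 i
  have e1 := h θ h1 h2 i
  have e2 := h' θ h1 h2 i
  have e3 : ∫ r, (θ r : ℂ) * (c + c') r i
      = (∫ r, (θ r : ℂ) * c r i) + ∫ r, (θ r : ℂ) * c' r i := by
    rw [← integral_add (integrable_coord_mul h1.continuous h2 hc i)
      (integrable_coord_mul h1.continuous h2 hc' i)]
    exact integral_congr_ae (.of_forall fun r => by simp [mul_add])
  rw [e3, e1, e2, ← neg_add, ← integral_add (integrable_curl h1 h2 hu i)
    (integrable_curl h1 h2 hu' i)]
  congr 1
  exact integral_congr_ae (.of_forall fun r => by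
    simp only [Pi.add_apply, PiLp.add_apply]; ring)

theorem smul (a : ℂ) (h : HasWeakCurl u c) : HasWeakCurl (a • u) (a • c) := by
  intro θ h1 h2 i
  have e1 := h θ h1 h2 i
  have e3 : ∫ r, (θ r : ℂ) * (a • c) r i = a * ∫ r, (θ r : ℂ) * c r i := by
    rw [← integral_const_mul]
    exact integral_congr_ae (.of_forall fun r => by
      simp only [Pi.smul_apply, PiLp.smul_apply, smul_eq_mul]; ring)
  rw [e3, e1, mul_neg, ← integral_const_mul]
  congr 1
  exact integral_congr_ae (.of_forall fun r => by
    simp only [Pi.smul_apply, PiLp.smul_apply, smul_eq_mul]; ring)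

end HasWeakCurl

/-- The graph of the weak curl on square-integrable fields. -/
def curlGraph : Submodule ℂ (GlobalField × GlobalField) where
  carrier := {p | HasWeakCurl p.1 p.2}
  zero_mem' := by
    intro θ _ _ i
    have h0 : ((0 : GlobalField) : Space3 → Amplitude) =ᵐ[volume] 0 := Lp.coeFn_zero _ _ _
    have h1 : ∫ r, (θ r : ℂ) * ((0 : GlobalField) : Space3 → Amplitude) r i = 0 := by
      rw [integral_congr_ae (g := fun _ => 0)
        (by filter_upwards [h0] with r hr; rw [hr]; simp), integral_zero]
    change ∫ r, (θ r : ℂ) * ((0 : GlobalField) : Space3 → Amplitude) r i = _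
    rw [h1, eq_comm, neg_eq_zero, integral_congr_ae (g := fun _ => 0), integral_zero]
    filter_upwards [h0] with r hr
    change _ * ((0 : GlobalField) : Space3 → Amplitude) r _
      - _ * ((0 : GlobalField) : Space3 → Amplitude) r _ = 0
    rw [hr]; simp
  add_mem' {p q} hp hq :=
    (HasWeakCurl.add (Lp.memLp _) (Lp.memLp _) (Lp.memLp _) (Lp.memLp _) hp hq).congr_ae
      (Lp.coeFn_add p.1 q.1).symm (Lp.coeFn_add p.2 q.2).symm
  smul_mem' a p hp :=
    (HasWeakCurl.smul a hp).congr_ae (Lp.coeFn_smul a p.1).symm (Lp.coeFn_smul a p.2).symm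

theorem IsLossySolution.isLossyWeak {ω η : ℝ} {ε : Space3 → Amplitude →L[ℂ] Amplitude}
    {j e : Space3 → Amplitude} (h : IsLossySolution ω η ε j e)
    {E : GlobalField →L[ℂ] GlobalField}
    (hE : ∀ f : GlobalField, E f =ᵐ[volume] fun r => ε r ((f : Space3 → Amplitude) r))
    {s : GlobalField} (hs : s =ᵐ[volume] j) :
    IsLossyWeak curlGraph ω η E s (h.1.toLp e) := by
  obtain ⟨he, c, hc, hec, h⟩ := h
  refine ⟨hc.toLp c, hec.congr_ae he.coeFn_toLp.symm hc.coeFn_toLp.symm, fun p hp => ?_⟩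
  have h1 := h p.1 p.2 (Lp.memLp _) (Lp.memLp _) hp
  rw [L2.inner_def, L2.inner_def, L2.inner_def]
  convert h1 using 1
  · congr 1
    · refine integral_congr_ae ?_
      filter_upwards [hc.coeFn_toLp] with r hr
      rw [hr]
    · refine integral_congr_ae ?_
      filter_upwards [he.coeFn_toLp, hE (he.toLp e),
        Lp.coeFn_add (((ω : ℂ) ^ 2) • E (he.toLp e)) ((Complex.I * (η : ℂ)) • he.toLp e),
        Lp.coeFn_smul ((ω : ℂ) ^ 2) (E (he.toLp e)),
        Lp.coeFn_smul (Complex.I * (η : ℂ)) (he.toLp e)] with r h1 h2 h3 h4 h5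
      rw [h3, Pi.add_apply, h4, h5, Pi.smul_apply, Pi.smul_apply, h2, h1]
  · refine integral_congr_ae ?_
    filter_upwards [hs, Lp.coeFn_smul (Complex.I * (ω : ℂ)) s] with r h1 h2
    rw [h2, Pi.smul_apply, h1]

/-! ## Restriction, extension and pointwise multiplication -/

/-- Restriction of a field to the region `B`. -/
def restrictField (B : Set Space3) : GlobalField →L[ℂ] FieldSpace B :=
  LpToLpRestrictCLM Space3 Amplitude ℂ volume 2 B

theorem restrictField_coeFn (B : Set Space3) (f : GlobalField) :
    restrictField B f =ᵐ[(volume : Measure Space3).restrict B] f :=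
  LpToLpRestrictCLM_coeFn ℂ B f

/-- Extension of a field by zero outside the region `A`. -/
def extendField (A : Set Space3) (hA : MeasurableSet A) : FieldSpace A →L[ℂ] GlobalField :=
  LinearMap.mkContinuous
    { toFun := fun f => ((memLp_indicator_iff_restrict hA).2 (Lp.memLp f)).toLp _
      map_add' := fun f g => by
        rw [← MemLp.toLp_add]
        refine MemLp.toLp_congr _ _ ?_
        filter_upwards [(ae_restrict_iff' hA).1 (Lp.coeFn_add f g)] with r hr
        by_cases h : r ∈ A
        · simp only [Pi.add_apply, Set.indicator_of_mem h, hr h]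
        · simp [h]
      map_smul' := fun a f => by
        rw [RingHom.id_apply, ← MemLp.toLp_const_smul]
        refine MemLp.toLp_congr _ _ ?_
        filter_upwards [(ae_restrict_iff' hA).1 (Lp.coeFn_smul a f)] with r hr
        by_cases h : r ∈ A
        · simp [h, hr h]
        · simp [h] }
    1 (fun f => by
      simp only [LinearMap.coe_mk, AddHom.coe_mk, one_mul]
      rw [Lp.norm_toLp, eLpNorm_indicator_eq_eLpNorm_restrict hA, Lp.norm_def])

theorem extendField_coeFn (A : Set Space3) (hA : MeasurableSet A) (f : FieldSpace A) :
    extendField A hA f =ᵐ[volume] A.indicator (f : Space3 → Amplitude) := by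
  have h : MemLp (A.indicator (f : Space3 → Amplitude)) 2 volume :=
    (memLp_indicator_iff_restrict hA).2 (Lp.memLp f)
  exact h.coeFn_toLp

namespace PhotonicStructure

variable {D : Set Space3} (M : PhotonicStructure D)

theorem norm_proj_apply_le (r : Space3) (v : Amplitude) : ‖M.proj r v‖ ≤ ‖v‖ := by
  have h1 := (M.isStarProjection_proj r).norm_le
  simpa using ContinuousLinearMap.le_of_opNorm_le _ h1 v

theorem memLp_proj {μ : Measure Space3} {f : Space3 → Amplitude} (hf : MemLp f 2 μ) :
    MemLp (fun r => M.proj r (f r)) 2 μ := by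
  refine hf.of_le ?_ (.of_forall fun r => M.norm_proj_apply_le r (f r))
  exact (ContinuousLinearMap.apply ℂ Amplitude).flip.aestronglyMeasurable_comp₂
    M.measurable_proj.aestronglyMeasurable hf.1

/-- Pointwise multiplication by the projection field of the structure. -/
def projMul (μ : Measure Space3) : Lp Amplitude 2 μ →L[ℂ] Lp Amplitude 2 μ :=
  LinearMap.mkContinuous
    { toFun := fun f => (M.memLp_proj (Lp.memLp f)).toLp _
      map_add' := fun f g => by
        rw [← MemLp.toLp_add]
        refine MemLp.toLp_congr _ _ ?_
        filter_upwards [Lp.coeFn_add f g] with r hr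
        simp only [hr, Pi.add_apply, map_add]
      map_smul' := fun a f => by
        rw [RingHom.id_apply, ← MemLp.toLp_const_smul]
        refine MemLp.toLp_congr _ _ ?_
        filter_upwards [Lp.coeFn_smul a f] with r hr
        simp only [hr, Pi.smul_apply, map_smul] }
    1 (fun f => by
      rw [one_mul]
      refine Lp.norm_le_norm_of_ae_le ?_
      filter_upwards [(M.memLp_proj (Lp.memLp f)).coeFn_toLp] with r hr
      simp only [LinearMap.coe_mk, AddHom.coe_mk]
      rw [hr]
      exact M.norm_proj_apply_le r _)

theorem projMul_coeFn (μ : Measure Space3) (f : Lp Amplitude 2 μ) :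
    M.projMul μ f =ᵐ[μ] fun r => M.proj r ((f : Space3 → Amplitude) r) :=
  MemLp.coeFn_toLp (M.memLp_proj (Lp.memLp f))

end PhotonicStructure

/-! ## The polarization equation for Green's functions -/

/-- Lossy solutions approximating the outgoing field. -/
theorem IsGreenFunction.exists_lossy {ω : ℝ} {ε : Space3 → Amplitude →L[ℂ] Amplitude}
    {G : BlockOperators} (hG : IsGreenFunction ω ε G) {E : GlobalField →L[ℂ] GlobalField}
    (hE : ∀ f : GlobalField, E f =ᵐ[volume] fun r => ε r ((f : Space3 → Amplitude) r))
    {B A : Set Space3} (hB : MeasurableSet B) (hBb : Bornology.IsBounded B)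
    (hA : MeasurableSet A) (hAb : Bornology.IsBounded A) (j : FieldSpace A) :
    ∃ e : ℝ → GlobalField, (∀ η, 0 < η → IsLossyWeak curlGraph ω η E (extendField A hA j) (e η)) ∧
      Tendsto (fun η => restrictField B (e η)) (𝓝[>] 0)
        (𝓝 ((Complex.I / (ω : ℂ)) • G B A j)) := by
  classical
  obtain ⟨e, ⟨-, eη, hη, hlim⟩, hBe⟩ := hG B A hB hBb hA hAb j
  refine ⟨fun η => if h : 0 < η then (hη η h).1.toLp (eη η) else 0, fun η h => ?_, ?_⟩
  · simp only [h, dif_pos]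
    exact (hη η h).isLossyWeak hE (extendField_coeFn A hA j)
  · obtain ⟨ρ, hρ⟩ := hBb.subset_ball 0
    have h1 := hlim ρ
    rw [tendsto_iff_norm_sub_tendsto_zero]
    have h2 := (ENNReal.tendsto_toReal ENNReal.zero_ne_top).comp h1
    rw [ENNReal.toReal_zero] at h2
    refine squeeze_zero' (.of_forall fun _ => norm_nonneg _) ?_ h2
    have h3 : ∀ᶠ η in 𝓝[>] (0 : ℝ),
        eLpNorm (eη η - e) 2 ((volume : Measure Space3).restrict (Metric.ball 0 ρ)) < 1 :=
      h1.eventually_lt_const one_pos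
    filter_upwards [h3, self_mem_nhdsWithin] with η hfin hpos
    simp only [Set.mem_Ioi] at hpos
    simp only [hpos, dif_pos, Function.comp_apply]
    rw [Lp.norm_def]
    refine ENNReal.toReal_mono hfin.ne_top ?_
    refine le_trans (le_of_eq (eLpNorm_congr_ae ?_))
      (eLpNorm_mono_measure _ (Measure.restrict_mono hρ le_rfl))
    filter_upwards [hBe, restrictField_coeFn B ((hη η hpos).1.toLp (eη η)),
      ae_restrict_of_ae (s := B) (hη η hpos).1.coeFn_toLp,
      Lp.coeFn_sub (restrictField B ((hη η hpos).1.toLp (eη η)))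
        ((Complex.I / (ω : ℂ)) • G B A j),
      Lp.coeFn_smul (Complex.I / (ω : ℂ)) (G B A j)] with r h1 h2 h3 h4 h5
    rw [h4, Pi.sub_apply, Pi.sub_apply, h5, Pi.smul_apply, h1, h2, h3]

namespace PhotonicStructure

variable {S D : Set Space3} (M : PhotonicStructure D)

/-- The polarization current, as a function of the free current. -/
def polarization (χ : ℂ) (Gt : BlockOperators) : FieldSpace S →L[ℂ] FieldSpace D :=
  χ • (M.projMul _).comp (Gt D S)

/-- The field radiated by the free current is the field radiated in vacuum by the free current
and by the polarization current. -/
theorem greenFunction_eq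
    (hS : MeasurableSet S) (hSb : Bornology.IsBounded S)
    (hD : MeasurableSet D) (hDb : Bornology.IsBounded D)
    {ω : ℝ} (hω : 0 < ω) (χ : ℂ)
    {G₀ : BlockOperators} (hG₀ : IsGreenFunction ω vacuum G₀)
    {Gt : BlockOperators} (hGt : IsGreenFunction ω (M.permittivity χ) Gt)
    {B : Set Space3} (hB : MeasurableSet B) (hBb : Bornology.IsBounded B) (j : FieldSpace S) :
    Gt B S j = G₀ B S j + G₀ B D (M.polarization χ Gt j) := by
  let L := WithLp.prodContinuousLinearEquiv 2 ℂ (FieldSpace S) (FieldSpace D)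
  -- Sources are pairs (free current, polarization current). Overlap of S and D only costs
  -- injectivity of ι, which is never needed. With Q below, ι ∘ Q is multiplication by the
  -- projection field.
  let ι : JointSpace S D →L[ℂ] GlobalField :=
    ((extendField S hS).coprod (extendField D hD)).comp
      (L : JointSpace S D →L[ℂ] FieldSpace S × FieldSpace D)
  let Q₀ : GlobalField →L[ℂ] FieldSpace D := (M.projMul _).comp (restrictField D)
  let Q : GlobalField →L[ℂ] JointSpace S D :=
    (L.symm : FieldSpace S × FieldSpace D →L[ℂ] JointSpace S D).comp
      ((0 : GlobalField →L[ℂ] FieldSpace S).prod Q₀)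
  have hι : ∀ a b, ι (WithLp.toLp 2 (a, b)) = extendField S hS a + extendField D hD b :=
    fun _ _ => rfl
  have hQ : ∀ f, Q f = WithLp.toLp 2 (0, Q₀ f) := fun _ => rfl
  have hv : ∀ f : GlobalField, (1 : GlobalField →L[ℂ] GlobalField) f
      =ᵐ[volume] fun r => vacuum r ((f : Space3 → Amplitude) r) := fun f => .rfl
  have hm : ∀ f : GlobalField, (1 + χ • ι.comp Q) f
      =ᵐ[volume] fun r => M.permittivity χ r ((f : Space3 → Amplitude) r) := by
    intro f
    have h0 : (1 + χ • ι.comp Q) f = f + χ • extendField D hD (Q₀ f) := by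
      change f + χ • ι (Q f) = _
      rw [hQ, hι, map_zero, zero_add]
    rw [h0]
    filter_upwards [Lp.coeFn_add f (χ • extendField D hD (Q₀ f)),
      Lp.coeFn_smul χ (extendField D hD (Q₀ f)), extendField_coeFn D hD (Q₀ f),
      (ae_restrict_iff' hD).1 (M.projMul_coeFn _ (restrictField D f)),
      (ae_restrict_iff' hD).1 (restrictField_coeFn D f)] with r h1 h2 h3 h4 h5
    have h6 : D.indicator (Q₀ f : Space3 → Amplitude) r
        = M.proj r ((f : Space3 → Amplitude) r) := by
      by_cases h : r ∈ D
      · rw [Set.indicator_of_mem h, ← h5 h]; exact h4 h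
      · rw [Set.indicator_of_notMem h, M.proj_eq_zero r h]; rfl
    rw [h1, Pi.add_apply, h2, Pi.smul_apply, h3, h6]
    rfl
  have hex : ∀ {ε : Space3 → Amplitude →L[ℂ] Amplitude} {G : BlockOperators}
      {E : GlobalField →L[ℂ] GlobalField}, IsGreenFunction ω ε G →
      (∀ f : GlobalField, E f =ᵐ[volume] fun r => ε r ((f : Space3 → Amplitude) r)) →
      ∀ η : ℝ, 0 < η → ∀ v, ∃ e, IsLossyWeak curlGraph ω η E (ι v) e := by
    intro ε G E hG hE η hη v
    obtain ⟨e₁, h₁, -⟩ := hG.exists_lossy hE hB hBb hS hSb v.fst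
    obtain ⟨e₂, h₂, -⟩ := hG.exists_lossy hE hB hBb hD hDb v.snd
    exact ⟨_, (h₁ η hη).add (h₂ η hη)⟩
  have hvac := hex hG₀ hv
  have hmed := hex hGt hm
  -- Along a sequence, convergence implies boundedness, as the uniform boundedness principle
  -- requires.
  let t : ℕ → ℝ := fun n => 1 / ((n : ℝ) + 1)
  have ht : ∀ n, 0 < t n := fun n => Nat.one_div_pos_of_nat
  have htl : Tendsto t atTop (𝓝[>] 0) :=
    tendsto_nhdsWithin_iff.2 ⟨tendsto_one_div_add_atTop_nhds_zero_nat, .of_forall ht⟩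
  let g : JointSpace S D → FieldSpace B := fun v =>
    (Complex.I / (ω : ℂ)) • (G₀ B S v.fst + G₀ B D v.snd)
  have hg : ∀ (v : JointSpace S D) (e : ℕ → GlobalField),
      (∀ n, IsLossyWeak curlGraph ω (t n) 1 (ι v) (e n)) →
      Tendsto (fun n => restrictField B (e n)) atTop (𝓝 (g v)) := by
    intro v e he
    obtain ⟨e₁, h₁, l₁⟩ := hG₀.exists_lossy hv hB hBb hS hSb v.fst
    obtain ⟨e₂, h₂, l₂⟩ := hG₀.exists_lossy hv hB hBb hD hDb v.snd
    have := (l₁.comp htl).add (l₂.comp htl)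
    rw [← smul_add] at this
    refine this.congr fun n => ?_
    rw [(he n).unique_vacuum hω (ht n) ((h₁ _ (ht n)).add (h₂ _ (ht n))), map_add]
    rfl
  obtain ⟨e₁, h₁, l₁⟩ := hGt.exists_lossy hm hB hBb hS hSb j
  obtain ⟨e₂, h₂, l₂⟩ := hGt.exists_lossy hm hD hDb hS hSb j
  -- The fields observed on D and those observed on B come from separate existence statements;
  -- uniqueness in the medium identifies them.
  have heq : ∀ n, e₂ (t n) = e₁ (t n) := fun n =>
    IsLossyWeak.unique_medium hω χ ι Q hvac hmed (ht n) (h₂ _ (ht n)) (h₁ _ (ht n))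
  have hq : Tendsto (fun n => Q (e₁ (t n))) atTop
      (𝓝 (WithLp.toLp 2 (0, M.projMul _ ((Complex.I / (ω : ℂ)) • Gt D S j)))) := by
    have h3 : Continuous fun f : FieldSpace D =>
        (L.symm : FieldSpace S × FieldSpace D →L[ℂ] JointSpace S D) (0, M.projMul _ f) := by
      fun_prop
    refine ((h3.tendsto _).comp (l₂.comp htl)).congr fun n => ?_
    rw [← heq]
    rfl
  have hfin := IsLossyWeak.tendsto_medium hω χ ι Q (restrictField B) ht
    (fun n => hvac _ (ht n)) g hg (v := WithLp.toLp 2 (j, 0)) (e := fun n => e₁ (t n))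
    (fun n => by rw [hι, map_zero, add_zero]; exact h₁ _ (ht n)) hq
  have hlim := tendsto_nhds_unique hfin (l₁.comp htl)
  have hω' : (ω : ℂ) ≠ 0 := by exact_mod_cast hω.ne'
  have hc : Complex.I / (ω : ℂ) ≠ 0 := div_ne_zero Complex.I_ne_zero hω'
  have h4 : Gt B S j = G₀ B S (j - (Complex.I * ω * χ) • 0)
      + G₀ B D (0 - (Complex.I * ω * χ) • M.projMul _ ((Complex.I / (ω : ℂ)) • Gt D S j)) :=
    (smul_right_injective _ hc hlim).symm
  -- The remaining scalar is -(iωχ)(i/ω) = χ, the factor in `polarization`.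
  rw [h4, smul_zero, sub_zero, map_smul, smul_smul, zero_sub, ← neg_smul]
  congr 3
  field_simp
  rw [Complex.I_sq]
  ring

end PhotonicStructure

/-! ## Second moment operators and traces -/

/-- Distinct orthonormal vectors are √2 apart, so balls of radius 1/2 around them are disjoint.
Countability is what permits dominated convergence over an arbitrary Hilbert basis. -/
theorem Orthonormal.countable_index {ι E : Type*} [NormedAddCommGroup E] [InnerProductSpace ℂ E]
    [TopologicalSpace.SeparableSpace E] {v : ι → E} (hv : Orthonormal ℂ v) : Countable ι := by
  have hd : Pairwise (Function.onFun Disjoint fun i => Metric.ball (v i) (1 / 2)) := by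
    intro i j hij
    refine Metric.ball_disjoint_ball ?_
    have h1 : ‖v i - v j‖ ^ 2 = 2 := by
      rw [@norm_sub_sq ℂ, hv.1 i, hv.1 j, hv.2 hij]; norm_num
    rw [dist_eq_norm]
    nlinarith [norm_nonneg (v i - v j)]
  exact hd.countable_of_isOpen_disjoint (fun _ => Metric.isOpen_ball)
    (fun i => ⟨v i, Metric.mem_ball_self (by norm_num)⟩)

section SecondMoment

variable {Ω : Type*} [MeasurableSpace Ω] {γ : Measure Ω}

section

variable {E : Type*} [NormedAddCommGroup E] [InnerProductSpace ℂ E] {φ : Ω → E}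

/-- The operator `E[φ φ†]`. -/
def secondMoment (γ : Measure Ω) (φ : Ω → E) : E →L[ℂ] E :=
  ∫ x, InnerProductSpace.rankOne ℂ (φ x) (φ x) ∂γ

theorem integrable_rankOne (hφ : MemLp φ 2 γ) :
    Integrable (fun x => InnerProductSpace.rankOne ℂ (φ x) (φ x)) γ := by
  have h1 : Continuous fun v : E => InnerProductSpace.rankOne ℂ v v :=
    ((ContinuousLinearMap.smulRightL ℂ E E).continuous.comp (innerSL ℂ).continuous).clm_apply
      continuous_id
  refine (hφ.integrable_norm_pow (by norm_num)).mono' (h1.comp_aestronglyMeasurable hφ.1) ?_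
  refine .of_forall fun x => ?_
  rw [InnerProductSpace.norm_rankOne, ← sq]

variable [CompleteSpace E]

theorem inner_secondMoment (hφ : MemLp φ 2 γ) (x y : E) :
    ⟪x, secondMoment γ φ y⟫_ℂ = ∫ a, ⟪x, φ a⟫_ℂ * ⟪φ a, y⟫_ℂ ∂γ := by
  have h := integrable_rankOne hφ
  rw [secondMoment, ContinuousLinearMap.integral_apply h, ← integral_inner (h.apply_continuousLinearMap y)]
  refine integral_congr_ae (.of_forall fun a => ?_)
  simp [inner_smul_right, mul_comm]

theorem secondMoment_isPositive (hφ : MemLp φ 2 γ) : (secondMoment γ φ).IsPositive := by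
  rw [ContinuousLinearMap.isPositive_iff_complex]
  intro x
  have h : ⟪secondMoment γ φ x, x⟫_ℂ = ((∫ a, ‖⟪φ a, x⟫_ℂ‖ ^ 2 ∂γ : ℝ) : ℂ) := by
    have hi : ∀ a, ⟪x, φ a⟫_ℂ * ⟪φ a, x⟫_ℂ = ((‖⟪φ a, x⟫_ℂ‖ ^ 2 : ℝ) : ℂ) := fun a => by
      rw [← inner_conj_symm x (φ a), Complex.conj_mul']
      push_cast
      rfl
    rw [← inner_conj_symm, inner_secondMoment hφ]
    simp_rw [hi]
    rw [integral_complex_ofReal, Complex.conj_ofReal]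
  rw [h]
  exact ⟨by simp, by
    rw [RCLike.re_to_complex, Complex.ofReal_re]
    exact integral_nonneg fun a => by positivity⟩

end

/-- Parseval's expansion of ⟪φ, A φ⟫ is integrated term by term. The terms are dominated by (|⟪b i,
φ⟫|² + |⟪b i, A φ⟫|²) / 2, whose sum is the integrable function (‖φ‖² + ‖A φ‖²) / 2. -/
theorem hasTrace_comp_secondMoment {E : Type} [NormedAddCommGroup E] [InnerProductSpace ℂ E]
    [CompleteSpace E] [TopologicalSpace.SeparableSpace E] {φ : Ω → E}
    (hφ : MemLp φ 2 γ) (A : E →L[ℂ] E) :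
    HasTrace (A.comp (secondMoment γ φ)) (∫ a, ⟪φ a, A (φ a)⟫_ℂ ∂γ) := by
  intro ι b
  have : Countable ι := b.orthonormal.countable_index
  have hA : MemLp (fun a => A (φ a)) 2 γ := A.comp_memLp' hφ
  have hF : ∀ i, ⟪b i, (A.comp (secondMoment γ φ)) (b i)⟫_ℂ
      = ∫ a, ⟪φ a, b i⟫_ℂ * ⟪b i, A (φ a)⟫_ℂ ∂γ := by
    intro i
    rw [ContinuousLinearMap.comp_apply, ← ContinuousLinearMap.adjoint_inner_left,
      inner_secondMoment hφ]
    refine integral_congr_ae (.of_forall fun a => ?_)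
    change ⟪A.adjoint (b i), φ a⟫_ℂ * ⟪φ a, b i⟫_ℂ = _
    rw [ContinuousLinearMap.adjoint_inner_left, mul_comm]
  simp_rw [hF]
  have hsq : ∀ x : E, HasSum (fun i => ‖⟪b i, x⟫_ℂ‖ ^ 2) (‖x‖ ^ 2) := by
    intro x
    have h1 := (b.hasSum_inner_mul_inner x x).mapL Complex.reCLM
    rw [inner_self_eq_norm_sq_to_K] at h1
    simp only [Complex.reCLM_apply, Complex.coe_algebraMap, ← Complex.ofReal_pow,
      Complex.ofReal_re] at h1
    refine h1.congr_fun fun i => ?_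
    rw [← inner_conj_symm x (b i), Complex.conj_mul', ← Complex.ofReal_pow, Complex.ofReal_re]
  have hbd : ∀ a, HasSum (fun i => (‖⟪b i, φ a⟫_ℂ‖ ^ 2 + ‖⟪b i, A (φ a)⟫_ℂ‖ ^ 2) / 2)
      ((‖φ a‖ ^ 2 + ‖A (φ a)‖ ^ 2) / 2) := fun a =>
    ((hsq (φ a)).add (hsq (A (φ a)))).div_const 2
  refine hasSum_integral_of_dominated_convergence
    (fun i a => (‖⟪b i, φ a⟫_ℂ‖ ^ 2 + ‖⟪b i, A (φ a)⟫_ℂ‖ ^ 2) / 2) (fun i => ?_)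
    (fun i => .of_forall fun a => ?_) (.of_forall fun a => (hbd a).summable) ?_
    (.of_forall fun a => b.hasSum_inner_mul_inner (φ a) (A (φ a)))
  · exact (hφ.1.inner aestronglyMeasurable_const).mul (aestronglyMeasurable_const.inner hA.1)
  · rw [norm_mul, norm_inner_symm (φ a)]
    nlinarith [sq_nonneg (‖⟪b i, φ a⟫_ℂ‖ - ‖⟪b i, A (φ a)⟫_ℂ‖)]
  · simp_rw [fun a => (hbd a).tsum_eq]
    have h1 := hφ.integrable_norm_pow (by norm_num)
    have h2 := hA.integrable_norm_pow (by norm_num)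
    exact (h1.add h2).div_const 2

end SecondMoment

theorem FieldSpace.secondCountableTopology (S : Set Space3) :
    SecondCountableTopology (FieldSpace S) := by
  have : Fact ((2 : ℝ≥0∞) ≠ ∞) := ⟨by simp⟩
  infer_instance

theorem JointSpace.separableSpace (S D : Set Space3) :
    TopologicalSpace.SeparableSpace (JointSpace S D) := by
  have := FieldSpace.secondCountableTopology S
  have := FieldSpace.secondCountableTopology D
  infer_instance

/-! ## Complex Gaussian noise -/

section Gaussian

variable {m : ℕ} {N : ℝ}

/-- The density of the circular complex Gaussian law of variance `N`. -/
def gaussianDensity (N : ℝ) (z : ℂ) : ℝ := 1 / (Real.pi * N) * Real.exp (-‖z‖ ^ 2 / N)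

/-- The circular complex Gaussian law of variance `N`. -/
def gaussianLaw (N : ℝ) : Measure ℂ :=
  volume.withDensity fun z => ENNReal.ofReal (gaussianDensity N z)

theorem gaussianDensity_nonneg (hN : 0 < N) (z : ℂ) : 0 ≤ gaussianDensity N z := by
  unfold gaussianDensity; positivity

theorem continuous_gaussianDensity : Continuous (gaussianDensity N) := by
  unfold gaussianDensity; fun_prop

theorem integral_gaussianDensity (hN : 0 < N) : ∫ z, gaussianDensity N z = 1 := by
  have h := Complex.integral_rpow_mul_exp_neg_mul_rpow (p := 2) (q := 0) (b := 1 / N)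
    (by norm_num) (by norm_num) (by positivity)
  have h1 : ∫ z : ℂ, Real.exp (-‖z‖ ^ 2 / N) = Real.pi * N := by
    calc _ = ∫ x : ℂ, ‖x‖ ^ (0 : ℝ) * Real.exp (-(1 / N) * ‖x‖ ^ (2 : ℝ)) := by
          congr 1; ext x; rw [Real.rpow_zero, one_mul, Real.rpow_two]; congr 1; ring
      _ = _ := by
          rw [h]
          norm_num [Real.rpow_neg_one]
  have : Real.pi * N ≠ 0 := by positivity
  simp only [gaussianDensity]
  rw [integral_const_mul, h1, one_div_mul_cancel this]

theorem integral_normSq_mul_gaussianDensity (hN : 0 < N) :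
    ∫ z, gaussianDensity N z * ‖z‖ ^ 2 = N := by
  have h := Complex.integral_rpow_mul_exp_neg_mul_rpow (p := 2) (q := 2) (b := 1 / N)
    (by norm_num) (by norm_num) (by positivity)
  have h1 : ∫ z : ℂ, Real.exp (-‖z‖ ^ 2 / N) * ‖z‖ ^ 2 = Real.pi * N ^ 2 := by
    calc _ = ∫ x : ℂ, ‖x‖ ^ (2 : ℝ) * Real.exp (-(1 / N) * ‖x‖ ^ (2 : ℝ)) := by
          congr 1; ext x; rw [Real.rpow_two, mul_comm]; congr 2; ring
      _ = _ := by
          rw [h]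
          have : (-((2 : ℝ) + 2) / 2) = ((-2 : ℤ) : ℝ) := by norm_num
          rw [this, Real.rpow_intCast]
          norm_num [Real.Gamma_two]
  have : Real.pi * N ≠ 0 := by positivity
  simp only [gaussianDensity, mul_assoc]
  rw [integral_const_mul, h1]
  field_simp

/-- The integral is 1, whereas a non-integrable function would have the default integral 0. -/
theorem integrable_gaussianDensity (hN : 0 < N) : Integrable (gaussianDensity N) := by
  by_contra h
  have := integral_undef h
  rw [integral_gaussianDensity hN] at this
  exact one_ne_zero this

theorem integrable_normSq_mul_gaussianDensity (hN : 0 < N) :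
    Integrable fun z => gaussianDensity N z * ‖z‖ ^ 2 := by
  by_contra h
  have := integral_undef h
  rw [integral_normSq_mul_gaussianDensity hN] at this
  exact hN.ne' this

theorem isProbabilityMeasure_gaussianLaw (hN : 0 < N) : IsProbabilityMeasure (gaussianLaw N) := by
  constructor
  rw [gaussianLaw, withDensity_apply _ MeasurableSet.univ, Measure.restrict_univ,
    ← ofReal_integral_eq_lintegral_ofReal (integrable_gaussianDensity hN)
      (.of_forall (gaussianDensity_nonneg hN)), integral_gaussianDensity hN, ENNReal.ofReal_one]

theorem integral_gaussianLaw {E : Type*} [NormedAddCommGroup E] [NormedSpace ℝ E] (hN : 0 < N)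
    (f : ℂ → E) : ∫ z, f z ∂gaussianLaw N = ∫ z, gaussianDensity N z • f z := by
  rw [gaussianLaw, integral_withDensity_eq_integral_toReal_smul
    continuous_gaussianDensity.measurable.ennreal_ofReal (.of_forall fun _ => ENNReal.ofReal_lt_top)]
  simp_rw [ENNReal.toReal_ofReal (gaussianDensity_nonneg hN _)]

theorem memLp_id_gaussianLaw (hN : 0 < N) : MemLp (fun z : ℂ => z) 2 (gaussianLaw N) := by
  rw [memLp_two_iff_integrable_sq_norm (by fun_prop), gaussianLaw,
    integrable_withDensity_iff_integrable_smul'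
      continuous_gaussianDensity.measurable.ennreal_ofReal
      (.of_forall fun _ => ENNReal.ofReal_lt_top)]
  simp_rw [ENNReal.toReal_ofReal (gaussianDensity_nonneg hN _), smul_eq_mul]
  exact integrable_normSq_mul_gaussianDensity hN

theorem integral_id_gaussianLaw (hN : 0 < N) : ∫ z, z ∂gaussianLaw N = 0 := by
  rw [integral_gaussianLaw hN]
  have h := integral_neg_eq_self (fun z : ℂ => gaussianDensity N z • z) volume
  have h2 : ∀ z : ℂ, gaussianDensity N (-z) • (-z) = -(gaussianDensity N z • z) := fun z => by
    simp [gaussianDensity]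
  simp_rw [h2, integral_neg] at h
  exact self_eq_neg.1 h.symm

theorem integral_normSq_gaussianLaw (hN : 0 < N) : ∫ z, ‖z‖ ^ 2 ∂gaussianLaw N = N := by
  rw [integral_gaussianLaw hN]
  exact integral_normSq_mul_gaussianDensity hN

theorem gaussianNoise_density_eq (z : Fin m → ℂ) :
    (1 / (Real.pi * N)) ^ m * Real.exp (-(∑ k, ‖z k‖ ^ 2) / N)
      = ∏ k, gaussianDensity N (z k) := by
  simp only [gaussianDensity, Finset.prod_mul_distrib, Finset.prod_const, Finset.card_univ,
    Fintype.card_fin, ← Real.exp_sum]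
  rw [← Finset.sum_div, Finset.sum_neg_distrib]

/-- The density factorizes over the coordinates. Independence of the components, and so the
covariance N I, follows from this form. -/
theorem gaussianNoise_eq_pi (hN : 0 < N) :
    gaussianNoise m N = Measure.pi fun _ : Fin m => gaussianLaw N := by
  have := isProbabilityMeasure_gaussianLaw hN
  refine (Measure.pi_eq fun s hs => ?_).symm
  have hms : MeasurableSet (Set.univ.pi s) := .univ_pi hs
  simp_rw [gaussianNoise, gaussianNoise_density_eq]
  have hint : Integrable (fun z : Fin m → ℂ => ∏ k, gaussianDensity N (z k))
      (volume.restrict (Set.univ.pi s)) :=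
    (Integrable.fintype_prod (𝕜 := ℝ) (f := fun _ : Fin m => gaussianDensity N)
      fun _ => integrable_gaussianDensity hN).restrict
  rw [withDensity_apply _ hms, ← ofReal_integral_eq_lintegral_ofReal hint
    (.of_forall fun z => Finset.prod_nonneg fun k _ => gaussianDensity_nonneg hN _),
    volume_pi, Measure.restrict_pi_pi,
    integral_fintype_prod_eq_prod (𝕜 := ℝ) (fun _ : Fin m => gaussianDensity N),
    ENNReal.ofReal_prod_of_nonneg fun k _ => integral_nonneg (gaussianDensity_nonneg hN)]
  refine Finset.prod_congr rfl fun k _ => ?_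
  rw [gaussianLaw, withDensity_apply _ (hs k), ofReal_integral_eq_lintegral_ofReal
    (integrable_gaussianDensity hN).restrict (.of_forall (gaussianDensity_nonneg hN))]

theorem isProbabilityMeasure_gaussianNoise (hN : 0 < N) :
    IsProbabilityMeasure (gaussianNoise m N) := by
  have := isProbabilityMeasure_gaussianLaw hN
  rw [gaussianNoise_eq_pi hN]
  infer_instance

theorem measurePreserving_eval_gaussianNoise (hN : 0 < N) (k : Fin m) :
    MeasurePreserving (fun z : Fin m → ℂ => z k) (gaussianNoise m N) (gaussianLaw N) := by
  have := isProbabilityMeasure_gaussianLaw hN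
  rw [gaussianNoise_eq_pi hN]
  exact measurePreserving_eval _ k

theorem memLp_coord_gaussianNoise (hN : 0 < N) (k : Fin m) :
    MemLp (fun z : Fin m → ℂ => z k) 2 (gaussianNoise m N) :=
  (memLp_id_gaussianLaw hN).comp_measurePreserving (measurePreserving_eval_gaussianNoise hN k)

theorem integral_coord_gaussianNoise (hN : 0 < N) (k : Fin m) :
    ∫ z, z k ∂gaussianNoise m N = 0 := by
  rw [← integral_id_gaussianLaw hN, ← (measurePreserving_eval_gaussianNoise hN k).map_eq,
    integral_map (measurable_pi_apply k).aemeasurable (by fun_prop)]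

theorem integral_normSq_coord_gaussianNoise (hN : 0 < N) (k : Fin m) :
    ∫ z, ‖z k‖ ^ 2 ∂gaussianNoise m N = N := by
  conv_rhs => rw [← integral_normSq_gaussianLaw hN,
    ← (measurePreserving_eval_gaussianNoise hN k).map_eq,
    integral_map (measurable_pi_apply k).aemeasurable (by fun_prop)]

theorem integral_mul_conj_gaussianNoise (hN : 0 < N) (a b : Fin m) :
    ∫ z, z a * (starRingEnd ℂ) (z b) ∂gaussianNoise m N = if a = b then (N : ℂ) else 0 := by
  split_ifs with h
  · subst h
    simp_rw [Complex.mul_conj']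
    norm_cast
    rw [integral_normSq_coord_gaussianNoise hN]
  · have := isProbabilityMeasure_gaussianLaw hN
    have hind : ProbabilityTheory.IndepFun (fun z : Fin m → ℂ => z a) (fun z => z b)
        (gaussianNoise m N) := by
      rw [gaussianNoise_eq_pi hN]
      exact (ProbabilityTheory.iIndepFun_pi (X := fun _ (z : ℂ) => z)
        (fun _ => aemeasurable_id)).indepFun h
    have h2 := hind.comp measurable_id (Complex.continuous_conj.measurable)
    have h3 := h2.integral_fun_mul_eq_mul_integral
      (by exact (measurable_pi_apply a).aestronglyMeasurable)
      (by exact (Complex.continuous_conj.measurable.comp (measurable_pi_apply b)).aestronglyMeasurable)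
    simp only [Function.comp_apply, id_eq] at h3
    rw [h3, integral_coord_gaussianNoise hN, zero_mul]

end Gaussian

/-! ## Entropy bounds -/

section Entropy

variable {m : ℕ} {N : ℝ}

/-- The density of Gaussian noise on `ℂᵐ`. -/
def noiseDensity (N : ℝ) (z : Fin m → ℂ) : ℝ :=
  (1 / (Real.pi * N)) ^ m * Real.exp (-(∑ k, ‖z k‖ ^ 2) / N)

theorem continuous_noiseDensity : Continuous (noiseDensity (m := m) N) := by
  unfold noiseDensity; fun_prop

theorem noiseDensity_pos (hN : 0 < N) (z : Fin m → ℂ) : 0 < noiseDensity N z := by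
  unfold noiseDensity; positivity

theorem noiseDensity_le (hN : 0 < N) (z : Fin m → ℂ) :
    noiseDensity N z ≤ (1 / (Real.pi * N)) ^ m := by
  refine mul_le_of_le_one_right (by positivity) (Real.exp_le_one_iff.2 ?_)
  rw [neg_div, neg_nonpos]
  positivity

theorem log_one_div_noiseDensity (hN : 0 < N) (z : Fin m → ℂ) :
    Real.log (1 / noiseDensity N z) = m * Real.log (Real.pi * N) + (∑ k, ‖z k‖ ^ 2) / N := by
  have : 0 < Real.pi * N := by positivity
  rw [noiseDensity, one_div, Real.log_inv, Real.log_mul (by positivity) (Real.exp_ne_zero _),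
    Real.log_exp, Real.log_pow, one_div, Real.log_inv]
  ring

theorem integrable_noiseDensity (hN : 0 < N) : Integrable (noiseDensity (m := m) N) := by
  unfold noiseDensity
  simp_rw [gaussianNoise_density_eq]
  exact Integrable.fintype_prod (𝕜 := ℝ) (f := fun _ : Fin m => gaussianDensity N)
    fun _ => integrable_gaussianDensity hN

theorem integral_noiseDensity (hN : 0 < N) : ∫ z : Fin m → ℂ, noiseDensity N z = 1 := by
  unfold noiseDensity
  simp_rw [gaussianNoise_density_eq]
  rw [integral_fintype_prod_volume_eq_prod (𝕜 := ℝ) (fun _ : Fin m => gaussianDensity N)]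
  simp [integral_gaussianDensity hN]

theorem integral_gaussianNoise (hN : 0 < N) (f : (Fin m → ℂ) → ℝ) :
    ∫ z, f z ∂gaussianNoise m N = ∫ z, noiseDensity N z * f z := by
  change ∫ z, f z ∂(volume.withDensity fun z => ENNReal.ofReal (noiseDensity N z)) = _
  rw [integral_withDensity_eq_integral_toReal_smul
    continuous_noiseDensity.measurable.ennreal_ofReal (.of_forall fun _ => ENNReal.ofReal_lt_top)]
  simp_rw [ENNReal.toReal_ofReal (noiseDensity_pos hN _).le, smul_eq_mul]

theorem condOutputLaw_eq_withDensity {X : Type*} (h : X → Fin m → ℂ) (N : ℝ) (x : X) :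
    condOutputLaw h N x
      = volume.withDensity fun y => ENNReal.ofReal (noiseDensity N (y - h x)) := by
  ext s hs
  rw [condOutputLaw, Measure.map_apply (by fun_prop) hs, withDensity_apply _ hs,
    ← lintegral_indicator hs, ← lintegral_add_left_eq_self _ (h x)]
  change (volume.withDensity fun z => ENNReal.ofReal (noiseDensity N z)) _ = _
  have hs' : MeasurableSet ((fun n => h x + n) ⁻¹' s) := (by fun_prop : Measurable _) hs
  rw [withDensity_apply _ hs', ← lintegral_indicator hs']
  refine lintegral_congr fun y => ?_
  simp only [Set.indicator, add_sub_cancel_left]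
  rfl

/-- Entropy is translation invariant, so the input drops out and the noise entropy m log₂(πeN)
remains. -/
theorem diffEntropy_condOutputLaw {Y : Type*} {h : Y → Fin m → ℂ} (hN : 0 < N) (x : Y) :
    diffEntropy (condOutputLaw h N x)
      = (m * Real.log (Real.pi * N) + m) / Real.log 2 := by
  have := isProbabilityMeasure_gaussianNoise (m := m) hN
  have hr : (condOutputLaw h N x).rnDeriv volume
      =ᵐ[volume] fun y => ENNReal.ofReal (noiseDensity N (y - h x)) := by
    rw [condOutputLaw_eq_withDensity]
    refine Measure.rnDeriv_withDensity _ (Measurable.ennreal_ofReal ?_)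
    exact (continuous_noiseDensity.comp (continuous_id.sub continuous_const)).measurable
  let f : (Fin m → ℂ) → ℝ := fun z => noiseDensity N z * Real.logb 2 (1 / noiseDensity N z)
  have h1 : diffEntropy (condOutputLaw h N x) = ∫ y, f (y - h x) := by
    refine integral_congr_ae ?_
    filter_upwards [hr] with y hy
    rw [hy, ENNReal.toReal_ofReal (noiseDensity_pos hN _).le]
  rw [h1, integral_sub_right_eq_self f (h x), ← integral_gaussianNoise hN]
  simp_rw [Real.logb, log_one_div_noiseDensity hN]
  have hi : ∀ k : Fin m, Integrable (fun z : Fin m → ℂ => ‖z k‖ ^ 2) (gaussianNoise m N) :=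
    fun k => (memLp_coord_gaussianNoise hN k).integrable_norm_pow (by norm_num)
  rw [integral_div, integral_add (integrable_const _)
    ((integrable_finsetSum _ fun k _ => hi k).div_const _), integral_div,
    integral_finsetSum _ fun k _ => hi k]
  simp_rw [integral_normSq_coord_gaussianNoise hN]
  simp [hN.ne']

section Output

variable {X : Type*} [MeasurableSpace X] {γ : Measure X} {h : X → Fin m → ℂ}

/-- The output density is a mixture of translated noise densities. It is therefore bounded by the
noise peak, which `diffEntropy_le` needs. -/
theorem outputLaw_eq_withDensity [IsProbabilityMeasure γ] (hN : 0 < N) (hh : Measurable h) :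
    outputLaw h N γ
      = volume.withDensity fun y => ∫⁻ x, ENNReal.ofReal (noiseDensity N (y - h x)) ∂γ := by
  have := isProbabilityMeasure_gaussianNoise (m := m) hN
  have hm : Measurable fun p : X × (Fin m → ℂ) => h p.1 + p.2 :=
    (hh.comp measurable_fst).add measurable_snd
  ext s hs
  rw [outputLaw, Measure.map_apply hm hs, Measure.prod_apply (hm hs), withDensity_apply _ hs,
    lintegral_lintegral_swap]
  · refine lintegral_congr fun x => ?_
    have h1 : condOutputLaw h N x s = gaussianNoise m N ((fun n => h x + n) ⁻¹' s) :=
      Measure.map_apply (by fun_prop) hs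
    rw [condOutputLaw_eq_withDensity, withDensity_apply _ hs] at h1
    rw [h1]
    rfl
  · refine Measurable.aemeasurable ?_
    exact (continuous_noiseDensity.measurable.comp
      (measurable_fst.sub (hh.comp measurable_snd))).ennreal_ofReal

theorem memLp_coord_outputLaw [IsProbabilityMeasure γ] (hN : 0 < N) (hh : Measurable h)
    (h2 : ∀ k, MemLp (fun x => h x k) 2 γ) (k : Fin m) :
    MemLp (fun y : Fin m → ℂ => y k) 2 (outputLaw h N γ) := by
  have := isProbabilityMeasure_gaussianNoise (m := m) hN
  have hm : Measurable fun p : X × (Fin m → ℂ) => h p.1 + p.2 :=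
    (hh.comp measurable_fst).add measurable_snd
  rw [outputLaw, memLp_map_measure_iff (measurable_pi_apply k).aestronglyMeasurable
    hm.aemeasurable]
  exact ((h2 k).comp_measurePreserving measurePreserving_fst).add
    ((memLp_coord_gaussianNoise hN k).comp_measurePreserving measurePreserving_snd)

theorem integrable_mul_conj {Ω : Type*} [MeasurableSpace Ω] {μ : Measure Ω} {f g : Ω → ℂ}
    (hf : MemLp f 2 μ) (hg : MemLp g 2 μ) :
    Integrable (fun x => f x * (starRingEnd ℂ) (g x)) μ :=
  hf.integrable_mul hg.star

theorem integral_mul_conj_outputLaw [IsProbabilityMeasure γ] (hN : 0 < N) (hh : Measurable h)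
    (h2 : ∀ k, MemLp (fun x => h x k) 2 γ) (a b : Fin m) :
    ∫ y, y a * (starRingEnd ℂ) (y b) ∂outputLaw h N γ
      = (∫ x, h x a * (starRingEnd ℂ) (h x b) ∂γ) + if a = b then (N : ℂ) else 0 := by
  have := isProbabilityMeasure_gaussianNoise (m := m) hN
  have hm : Measurable fun p : X × (Fin m → ℂ) => h p.1 + p.2 :=
    (hh.comp measurable_fst).add measurable_snd
  have hn := fun k => memLp_coord_gaussianNoise (m := m) hN k
  have hc1 : ∀ k, Integrable (fun x => (starRingEnd ℂ) (h x k)) γ := fun k =>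
    ((h2 k).star).integrable (by norm_num)
  have hc2 : ∀ k, Integrable (fun z : Fin m → ℂ => (starRingEnd ℂ) (z k)) (gaussianNoise m N) :=
    fun k => ((hn k).star).integrable (by norm_num)
  rw [outputLaw, integral_map hm.aemeasurable (by
    exact (Continuous.mul (continuous_apply a)
      (Complex.continuous_conj.comp (continuous_apply b))).aestronglyMeasurable)]
  have e : ∀ p : X × (Fin m → ℂ), (h p.1 + p.2) a * (starRingEnd ℂ) ((h p.1 + p.2) b)
      = ((h p.1 a * (starRingEnd ℂ) (h p.1 b)) * 1 + h p.1 a * (starRingEnd ℂ) (p.2 b))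
        + ((starRingEnd ℂ) (h p.1 b) * p.2 a + 1 * (p.2 a * (starRingEnd ℂ) (p.2 b))) := by
    intro p
    simp only [Pi.add_apply, map_add]
    ring
  simp_rw [e]
  have i1 := (integrable_mul_conj (h2 a) (h2 b)).mul_prod
    (integrable_const (μ := gaussianNoise m N) (1 : ℂ))
  have i2 := ((h2 a).integrable (by norm_num)).mul_prod (hc2 b)
  have i3 := (hc1 b).mul_prod ((hn a).integrable (by norm_num))
  have i4 := (integrable_const (μ := γ) (1 : ℂ)).mul_prod (integrable_mul_conj (hn a) (hn b))
  rw [integral_add (by exact i1.add i2) (by exact i3.add i4), integral_add i1 i2,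
    integral_add i3 i4,
    integral_prod_mul (fun x => h x a * (starRingEnd ℂ) (h x b)) (fun _ => (1 : ℂ)),
    integral_prod_mul (fun x => h x a) (fun z : Fin m → ℂ => (starRingEnd ℂ) (z b)),
    integral_prod_mul (fun x => (starRingEnd ℂ) (h x b)) (fun z : Fin m → ℂ => z a),
    integral_prod_mul (fun _ => (1 : ℂ)) (fun z : Fin m → ℂ => z a * (starRingEnd ℂ) (z b)),
    integral_mul_conj_gaussianNoise hN, integral_coord_gaussianNoise hN, integral_conj,
    integral_coord_gaussianNoise hN]
  simp

/-- Gibbs' inequality for differential entropy. -/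
theorem diffEntropy_le {μ : Measure (Fin m → ℂ)} [IsProbabilityMeasure μ]
    {p : (Fin m → ℂ) → ℝ≥0∞} (hp : Measurable p) (hμ : μ = volume.withDensity p) {c : ℝ}
    (hpc : ∀ y, p y ≤ ENNReal.ofReal c) {g : (Fin m → ℂ) → ℝ} (hg : ∀ y, 0 < g y)
    (hgi : Integrable g) (hg1 : ∫ y, g y ≤ 1)
    (hlog : Integrable (fun y => Real.log (1 / g y)) μ) :
    diffEntropy μ ≤ (∫ y, Real.log (1 / g y) ∂μ) / Real.log 2 := by
  have hac : μ ≪ volume := hμ ▸ withDensity_absolutelyContinuous _ _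
  set r : (Fin m → ℂ) → ℝ := fun y => (μ.rnDeriv volume y).toReal with hr
  have hr0 : ∀ y, 0 ≤ r y := fun y => ENNReal.toReal_nonneg
  have hri : Integrable r := Measure.integrable_toReal_rnDeriv
  have hr1 : ∫ y, r y = 1 := by
    rw [hr, Measure.integral_toReal_rnDeriv hac]; simp
  have hrm : Measurable r := (Measure.measurable_rnDeriv _ _).ennreal_toReal
  have hrc : ∀ᵐ y, r y ≤ c ∨ r y = 0 := by
    have h1 : μ.rnDeriv volume =ᵐ[volume] p := hμ ▸ Measure.rnDeriv_withDensity _ hp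
    filter_upwards [h1] with y hy
    have h2 : r y ≤ (ENNReal.ofReal c).toReal := by
      rw [hr]
      simp only [hy]
      exact ENNReal.toReal_mono ENNReal.ofReal_ne_top (hpc y)
    rcases le_total 0 c with hc | hc
    · rw [ENNReal.toReal_ofReal hc] at h2
      exact .inl h2
    · rw [ENNReal.ofReal_of_nonpos hc, ENNReal.toReal_zero] at h2
      exact .inr (le_antisymm h2 (hr0 y))
  have hrl : Integrable fun y => r y * Real.log (1 / g y) :=
    (integrable_rnDeriv_smul_iff hac).2 hlog
  -- Pointwise Gibbs: log x ≤ x - 1 at x = g / r, multiplied by r.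
  have hup : ∀ y, r y * Real.log (1 / r y) ≤ r y * Real.log (1 / g y) + g y - r y := by
    intro y
    rcases (hr0 y).eq_or_lt with h0 | h0
    · rw [← h0]; simpa using (hg y).le
    · have h1 := Real.log_le_sub_one_of_pos (div_pos (hg y) h0)
      rw [Real.log_div (hg y).ne' h0.ne'] at h1
      rw [one_div, one_div, Real.log_inv, Real.log_inv]
      have h2 := mul_le_mul_of_nonneg_left h1 h0.le
      have h3 : r y * (g y / r y - 1) = g y - r y := by field_simp
      rw [h3] at h2
      linarith
  -- The bound on the density controls the entropy integrand from below. Together with `hup` it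
  -- gives integrability, without which the entropy would be the default value 0.
  have hlow : ∀ᵐ y, -(r y * |Real.log c|) ≤ r y * Real.log (1 / r y) := by
    filter_upwards [hrc] with y hy
    rcases (hr0 y).eq_or_lt with h0 | h0
    · rw [← h0]; simp
    · rcases hy with hy | hy
      · rw [one_div, Real.log_inv, ← mul_neg]
        refine mul_le_mul_of_nonneg_left (neg_le_neg ?_) h0.le
        exact (Real.log_le_log h0 hy).trans (le_abs_self _)
      · exact absurd hy h0.ne'
  have hbi : Integrable fun y => r y * Real.log (1 / g y) + g y - r y := (hrl.add hgi).sub hri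
  have hint : Integrable fun y => r y * Real.log (1 / r y) := by
    refine ((hri.mul_const |Real.log c|).add hbi.abs).mono' ?_ ?_
    · exact (hrm.mul (Real.measurable_log.comp (hrm.const_div 1))).aestronglyMeasurable
    · filter_upwards [hlow] with y hy
      rw [Real.norm_eq_abs, abs_le]
      have h1 := hup y
      have h2 := le_abs_self (r y * Real.log (1 / g y) + g y - r y)
      have h3 : 0 ≤ r y * |Real.log c| := mul_nonneg (hr0 y) (abs_nonneg _)
      have h4 := abs_nonneg (r y * Real.log (1 / g y) + g y - r y)
      simp only [Pi.add_apply]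
      constructor <;> linarith
  have hmain : ∫ y, r y * Real.log (1 / r y) ≤ ∫ y, Real.log (1 / g y) ∂μ := by
    have h1 := integral_mono hint hbi hup
    rw [integral_sub (by exact hrl.add hgi) hri, integral_add hrl hgi, hr1] at h1
    have h2 : ∫ y, r y * Real.log (1 / g y) = ∫ y, Real.log (1 / g y) ∂μ :=
      integral_rnDeriv_smul hac
    linarith
  have h3 : diffEntropy μ = (∫ y, r y * Real.log (1 / r y)) / Real.log 2 := by
    rw [← integral_div]
    refine integral_congr_ae (.of_forall fun y => ?_)
    simp only [Real.logb, hr, mul_div_assoc]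
  rw [h3]
  exact div_le_div_of_nonneg_right hmain (Real.log_nonneg (by norm_num))

end Output

end Entropy

/-! ## The Gaussian bound on mutual information -/

section MutualInformation

open scoped Matrix ComplexOrder

variable {m : ℕ} {N : ℝ}

/-- A is the inverse of the Hermitian square root of K. In the coordinates A y, a vector with second
moments K becomes white. -/
theorem Matrix.PosDef.exists_whitening {K : Matrix (Fin m) (Fin m) ℂ} (hK : K.PosDef) :
    ∃ A : Matrix (Fin m) (Fin m) ℂ, A * K * Aᴴ = 1 := by
  open scoped MatrixOrder Matrix.Norms.L2Operator in
  have h0 : 0 ≤ K := hK.posSemidef.nonneg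
  have h1 : CFC.sqrt K * CFC.sqrt K = K := CFC.sqrt_mul_sqrt_self K h0
  have h2 : (CFC.sqrt K)ᴴ = CFC.sqrt K := (CFC.sqrt_nonneg K).isSelfAdjoint
  have h3 : IsUnit (CFC.sqrt K) := by
    have := hK.isUnit
    rw [← h1] at this
    exact (Commute.refl _).isUnit_mul_iff.1 this |>.1
  have h4 := (Matrix.isUnit_iff_isUnit_det _).1 h3
  refine ⟨(CFC.sqrt K)⁻¹, ?_⟩
  rw [Matrix.conjTranspose_nonsing_inv, h2]
  nth_rewrite 2 [← h1]
  rw [← Matrix.mul_assoc, Matrix.nonsing_inv_mul _ h4, Matrix.one_mul,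
    Matrix.mul_nonsing_inv _ h4]

/-- The Gaussian density obtained from white noise by the linear change of variables `A`. -/
def whitenedDensity (A : Matrix (Fin m) (Fin m) ℂ) (y : Fin m → ℂ) : ℝ :=
  Complex.normSq A.det * noiseDensity 1 (A *ᵥ y)

/-- The real determinant of a complex-linear map is the squared modulus of its complex determinant.
-/
theorem map_mulVec_volume {A : Matrix (Fin m) (Fin m) ℂ} (hA : A.det ≠ 0) :
    (volume : Measure (Fin m → ℂ)).map (fun y => A *ᵥ y)
      = ENNReal.ofReal (Complex.normSq A.det)⁻¹ • volume := by
  have hdet : LinearMap.det ((Matrix.toLin' A).restrictScalars ℝ) = Complex.normSq A.det := by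
    rw [LinearMap.det_restrictScalars, LinearMap.det_toLin', Algebra.norm_complex_apply]
  have hpos : 0 < Complex.normSq A.det := Complex.normSq_pos.2 hA
  have h := Measure.map_linearMap_addHaar_eq_smul_addHaar (volume : Measure (Fin m → ℂ))
    (f := (Matrix.toLin' A).restrictScalars ℝ) (by rw [hdet]; exact hpos.ne')
  rw [hdet, abs_of_pos (inv_pos.2 hpos)] at h
  exact h

theorem integrable_whitenedDensity {A : Matrix (Fin m) (Fin m) ℂ} (hA : A.det ≠ 0) :
    Integrable (whitenedDensity A) := by
  have hm : Measurable fun y : Fin m → ℂ => A *ᵥ y := by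
    exact (Matrix.mulVecLin A).continuous_of_finiteDimensional.measurable
  have h1 : Integrable (noiseDensity (m := m) 1)
      ((volume : Measure (Fin m → ℂ)).map (fun y => A *ᵥ y)) := by
    rw [map_mulVec_volume hA]
    exact (integrable_noiseDensity one_pos).smul_measure ENNReal.ofReal_ne_top
  exact (h1.comp_measurable hm).const_mul _

theorem integral_whitenedDensity {A : Matrix (Fin m) (Fin m) ℂ} (hA : A.det ≠ 0) :
    ∫ y, whitenedDensity A y = 1 := by
  have hm : Measurable fun y : Fin m → ℂ => A *ᵥ y := by
    exact (Matrix.mulVecLin A).continuous_of_finiteDimensional.measurable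
  have hpos : 0 < Complex.normSq A.det := Complex.normSq_pos.2 hA
  simp only [whitenedDensity]
  rw [integral_const_mul, ← integral_map (f := noiseDensity 1) hm.aemeasurable
    continuous_noiseDensity.aestronglyMeasurable, map_mulVec_volume hA, integral_smul_measure,
    integral_noiseDensity one_pos, ENNReal.toReal_ofReal (inv_pos.2 hpos).le, smul_eq_mul, mul_one,
    mul_inv_cancel₀ hpos.ne']

theorem log_one_div_whitenedDensity {A : Matrix (Fin m) (Fin m) ℂ} (hA : A.det ≠ 0)
    (y : Fin m → ℂ) : Real.log (1 / whitenedDensity A y)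
      = (m * Real.log Real.pi - Real.log (Complex.normSq A.det)) + ∑ i, ‖(A *ᵥ y) i‖ ^ 2 := by
  have hpos : 0 < Complex.normSq A.det := Complex.normSq_pos.2 hA
  have h := log_one_div_noiseDensity one_pos (A *ᵥ y)
  have h1 := noiseDensity_pos one_pos (A *ᵥ y)
  rw [one_div, Real.log_inv, mul_one, div_one] at h
  rw [whitenedDensity, one_div, Real.log_inv, Real.log_mul hpos.ne' h1.ne']
  linarith

theorem mulVec_mul_conj_eq (A : Matrix (Fin m) (Fin m) ℂ) (y : Fin m → ℂ) (i : Fin m) :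
    (A *ᵥ y) i * (starRingEnd ℂ) ((A *ᵥ y) i)
      = ∑ a, ∑ b, A i a * (starRingEnd ℂ) (A i b) * (y a * (starRingEnd ℂ) (y b)) := by
  simp only [Matrix.mulVec, dotProduct, map_sum, Finset.sum_mul_sum, map_mul]
  exact Finset.sum_congr rfl fun a _ => Finset.sum_congr rfl fun b _ => by ring

theorem memLp_mulVec {Ω : Type*} [MeasurableSpace Ω] {μ : Measure Ω} {f : Ω → Fin m → ℂ}
    (hf : ∀ k, MemLp (fun x => f x k) 2 μ) (A : Matrix (Fin m) (Fin m) ℂ) (i : Fin m) :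
    MemLp (fun x => (A *ᵥ f x) i) 2 μ := by
  simp only [Matrix.mulVec, dotProduct]
  exact memLp_finsetSum _ fun k _ => (hf k).const_mul _

theorem integral_mulVec_mul_conj {Ω : Type*} [MeasurableSpace Ω] {μ : Measure Ω}
    {f : Ω → Fin m → ℂ} (hf : ∀ k, MemLp (fun x => f x k) 2 μ)
    (A : Matrix (Fin m) (Fin m) ℂ) (i : Fin m) :
    ∫ x, (A *ᵥ f x) i * (starRingEnd ℂ) ((A *ᵥ f x) i) ∂μ
      = (A * (Matrix.of fun a b => ∫ x, f x a * (starRingEnd ℂ) (f x b) ∂μ) * Aᴴ) i i := by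
  have hi : ∀ a b, Integrable (fun x => A i a * (starRingEnd ℂ) (A i b)
      * (f x a * (starRingEnd ℂ) (f x b))) μ := fun a b =>
    (integrable_mul_conj (hf a) (hf b)).const_mul _
  simp_rw [mulVec_mul_conj_eq]
  rw [integral_finsetSum _ fun a _ => integrable_finsetSum _ fun b _ => hi a b]
  simp_rw [fun a => integral_finsetSum Finset.univ (μ := μ) fun b _ => hi a b,
    integral_const_mul, Matrix.mul_apply, Finset.sum_mul]
  rw [Finset.sum_comm]
  refine Finset.sum_congr rfl fun b _ => Finset.sum_congr rfl fun a _ => ?_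
  simp only [Matrix.of_apply, Matrix.conjTranspose_apply, RCLike.star_def]
  ring

/-- The quadratic form at v is the integral of |v† f|². -/
theorem posSemidef_secondMoments {Ω : Type*} [MeasurableSpace Ω] {μ : Measure Ω}
    {f : Ω → Fin m → ℂ} (hf : ∀ k, MemLp (fun x => f x k) 2 μ) :
    (Matrix.of fun a b => ∫ x, f x a * (starRingEnd ℂ) (f x b) ∂μ).PosSemidef := by
  refine .of_dotProduct_mulVec_nonneg ?_ fun v => ?_
  · ext a b
    rw [Matrix.conjTranspose_apply, Matrix.of_apply, Matrix.of_apply, RCLike.star_def,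
      ← integral_conj]
    refine integral_congr_ae (.of_forall fun x => ?_)
    simp [mul_comm]
  · have hi : ∀ a b, Integrable (fun x => (starRingEnd ℂ) (v a) * (f x a
        * (starRingEnd ℂ) (f x b)) * v b) μ := fun a b =>
      ((integrable_mul_conj (hf a) (hf b)).const_mul _).mul_const _
    have h : star v ⬝ᵥ (Matrix.of fun a b => ∫ x, f x a * (starRingEnd ℂ) (f x b) ∂μ) *ᵥ v
        = ((∫ x, ‖∑ a, (starRingEnd ℂ) (v a) * f x a‖ ^ 2 ∂μ : ℝ) : ℂ) := by
      rw [← integral_complex_ofReal]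
      have e : ∀ x, ((‖∑ a, (starRingEnd ℂ) (v a) * f x a‖ ^ 2 : ℝ) : ℂ)
          = ∑ a, ∑ b, (starRingEnd ℂ) (v a) * (f x a * (starRingEnd ℂ) (f x b)) * v b := by
        intro x
        push_cast
        rw [← Complex.mul_conj', map_sum, Finset.sum_mul_sum]
        refine Finset.sum_congr rfl fun a _ => Finset.sum_congr rfl fun b _ => ?_
        rw [map_mul, Complex.conj_conj]
        ring
      simp_rw [e]
      rw [integral_finsetSum _ fun a _ => integrable_finsetSum _ fun b _ => hi a b]
      simp_rw [fun a => integral_finsetSum Finset.univ (μ := μ) fun b _ => hi a b,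
        integral_mul_const, integral_const_mul, dotProduct, Matrix.mulVec, dotProduct,
        Finset.mul_sum, Pi.star_apply, Matrix.of_apply, RCLike.star_def, mul_assoc]
    rw [h]
    exact_mod_cast integral_nonneg fun x => by positivity

/-- Among all inputs with given second moments, Gaussian ones carry the most information. -/
theorem mutualInfo_le {X : Type*} [MeasurableSpace X] {γ : Measure X} [IsProbabilityMeasure γ]
    {h : X → Fin m → ℂ} (hN : 0 < N) (hh : Measurable h)
    (h2 : ∀ k, MemLp (fun x => h x k) 2 γ) :
    mutualInfo h N γ ≤ Real.logb 2 (1 + Matrix.of fun a b : Fin m =>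
      (N : ℂ)⁻¹ * ∫ x, h x a * (starRingEnd ℂ) (h x b) ∂γ : Matrix (Fin m) (Fin m) ℂ).det.re := by
  have hm : Measurable fun p : X × (Fin m → ℂ) => h p.1 + p.2 :=
    (hh.comp measurable_fst).add measurable_snd
  have := isProbabilityMeasure_gaussianNoise (m := m) hN
  have hprob : IsProbabilityMeasure (outputLaw h N γ) :=
    Measure.isProbabilityMeasure_map hm.aemeasurable
  have hNc : (N : ℂ) ≠ 0 := by exact_mod_cast hN.ne'
  let Q : Matrix (Fin m) (Fin m) ℂ := Matrix.of fun a b => ∫ x, h x a * (starRingEnd ℂ) (h x b) ∂γ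
  let K : Matrix (Fin m) (Fin m) ℂ :=
    Matrix.of fun a b => ∫ y, y a * (starRingEnd ℂ) (y b) ∂outputLaw h N γ
  let B : Matrix (Fin m) (Fin m) ℂ := 1 + Matrix.of fun a b : Fin m =>
      (N : ℂ)⁻¹ * ∫ x, h x a * (starRingEnd ℂ) (h x b) ∂γ
  have hKQ : K = Q + (N : ℂ) • (1 : Matrix (Fin m) (Fin m) ℂ) := by
    ext a b
    simp [K, Q, integral_mul_conj_outputLaw hN hh h2, Matrix.one_apply]
  have hKB : K = (N : ℂ) • B := by
    rw [hKQ]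
    ext a b
    simp [B, Q, Matrix.one_apply, hNc, mul_add, add_comm]
  have hKpos : K.PosDef := by
    rw [hKQ]
    have hN' : (0 : ℂ) < (N : ℂ) := by exact_mod_cast hN
    exact Matrix.PosDef.posSemidef_add (posSemidef_secondMoments h2) (Matrix.PosDef.one.smul hN')
  obtain ⟨A, hA⟩ := hKpos.exists_whitening
  -- Determinants of A K A† = 1 with K = N B: the normalization of the comparison Gaussian encodes
  -- the log-determinant of the bound.
  have hdetA : Complex.normSq A.det * N ^ m * B.det.re = 1 := by
    have h1 := congrArg Matrix.det hA
    rw [Matrix.det_mul, Matrix.det_mul, Matrix.det_conjTranspose, hKB, Matrix.det_smul,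
      Matrix.det_one, Fintype.card_fin, RCLike.star_def, mul_right_comm, Complex.mul_conj] at h1
    have h3 := congrArg Complex.re h1
    rw [← mul_assoc, ← Complex.ofReal_pow, ← Complex.ofReal_mul, Complex.re_ofReal_mul] at h3
    simpa using h3
  have hA0 : A.det ≠ 0 := by
    intro h0
    rw [h0] at hdetA
    simp at hdetA
  have hApos : 0 < Complex.normSq A.det := Complex.normSq_pos.2 hA0
  have hmem := memLp_coord_outputLaw hN hh h2
  have hsq : ∀ i, Integrable (fun y => ‖(A *ᵥ y) i‖ ^ 2) (outputLaw h N γ) := fun i =>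
    (memLp_mulVec hmem A i).integrable_norm_pow (by norm_num)
  -- Whitening makes the cross-entropy explicit. The moments are not centred: the comparison
  -- Gaussian has mean zero and Gibbs' inequality does not require equal means.
  have hsq1 : ∀ i, ∫ y, ‖(A *ᵥ y) i‖ ^ 2 ∂outputLaw h N γ = 1 := by
    intro i
    have h1 := integral_mulVec_mul_conj hmem A i
    change _ = (A * K * Aᴴ) i i at h1
    rw [hA, Matrix.one_apply_eq] at h1
    simp_rw [Complex.mul_conj', ← Complex.ofReal_pow] at h1
    rw [integral_complex_ofReal] at h1
    exact_mod_cast h1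
  have hent := diffEntropy_le (μ := outputLaw h N γ)
    (p := fun y => ∫⁻ x, ENNReal.ofReal (noiseDensity N (y - h x)) ∂γ)
    (Measurable.lintegral_prod_right' (f := fun p : (Fin m → ℂ) × X =>
        ENNReal.ofReal (noiseDensity N (p.1 - h p.2)))
      (continuous_noiseDensity.measurable.comp
        (measurable_fst.sub (hh.comp measurable_snd))).ennreal_ofReal)
    (outputLaw_eq_withDensity hN hh) (c := (1 / (Real.pi * N)) ^ m)
    (fun y => (lintegral_mono fun x => ENNReal.ofReal_le_ofReal (noiseDensity_le hN _)).trans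
      (by simp))
    (g := whitenedDensity A) (fun y => mul_pos hApos (noiseDensity_pos one_pos _))
    (integrable_whitenedDensity hA0) (integral_whitenedDensity hA0).le
    (by
      simp_rw [log_one_div_whitenedDensity hA0]
      exact (integrable_const _).add (integrable_finsetSum _ fun i _ => hsq i))
  simp_rw [log_one_div_whitenedDensity hA0] at hent
  rw [integral_add (integrable_const _) (integrable_finsetSum _ fun i _ => hsq i),
    integral_finsetSum _ fun i _ => hsq i] at hent
  simp_rw [hsq1] at hent
  have hB : B.det.re = (Complex.normSq A.det * N ^ m)⁻¹ := eq_inv_of_mul_eq_one_right hdetA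
  change _ ≤ Real.logb 2 B.det.re
  rw [mutualInfo, hB, Real.logb, Real.log_inv, Real.log_mul hApos.ne' (by positivity),
    Real.log_pow]
  simp_rw [diffEntropy_condOutputLaw hN]
  rw [Real.log_mul Real.pi_pos.ne' hN.ne']
  simp only [integral_const, probReal_univ, one_smul, Finset.sum_const, Finset.card_univ,
    Fintype.card_fin, nsmul_eq_mul, mul_one] at hent ⊢
  refine (sub_le_sub_right hent _).trans (le_of_eq ?_)
  ring

end MutualInformation

/-! ## Block operators -/

section Blocks

variable {E F K : Type*} [NormedAddCommGroup E] [InnerProductSpace ℂ E]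
  [NormedAddCommGroup F] [InnerProductSpace ℂ F] [NormedAddCommGroup K] [InnerProductSpace ℂ K]

theorem rowOp_toLp (a : E →L[ℂ] K) (b : F →L[ℂ] K) (x : E) (y : F) :
    rowOp a b (WithLp.toLp 2 (x, y)) = a x + b y := rfl

theorem blockOp_toLp (a : E →L[ℂ] E) (b : F →L[ℂ] E) (c : E →L[ℂ] F) (d : F →L[ℂ] F)
    (x : E) (y : F) :
    blockOp a b c d (WithLp.toLp 2 (x, y)) = WithLp.toLp 2 (a x + b y, c x + d y) := rfl

theorem inner_blockOp (a : E →L[ℂ] E) (b : F →L[ℂ] E) (c : E →L[ℂ] F) (d : F →L[ℂ] F)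
    (x : E) (y : F) :
    ⟪WithLp.toLp 2 (x, y), blockOp a b c d (WithLp.toLp 2 (x, y))⟫_ℂ
      = (⟪x, a x⟫_ℂ + ⟪x, b y⟫_ℂ) + (⟪y, c x⟫_ℂ + ⟪y, d y⟫_ℂ) := by
  rw [blockOp_toLp, WithLp.prod_inner_apply, inner_add_right, inner_add_right]

end Blocks

theorem inner_asym {E : Type*} [NormedAddCommGroup E] [InnerProductSpace ℂ E] [CompleteSpace E]
    (A : E →L[ℂ] E) (x : E) : ⟪x, asym A x⟫_ℂ = ((⟪x, A x⟫_ℂ).im : ℂ) := by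
  rw [asym, smul_apply, sub_apply, inner_smul_right, inner_sub_right,
    ContinuousLinearMap.adjoint_inner_right, ← inner_conj_symm (A x) x, Complex.sub_conj]
  field_simp [Complex.I_ne_zero]
  push_cast
  ring

/-! ## The quadratic forms of the program -/

variable {S D : Set Space3}

/-- The quadratic form of the drive-power operator is the extracted power plus the insertion
cost. -/
theorem inner_drivePowerOp {ω : ℝ} (hω : 0 < ω) (α : ℝ) (G₀ : BlockOperators)
    (x : FieldSpace S) (y : FieldSpace D) :
    ⟪(WithLp.toLp 2 (x, y) : JointSpace S D), drivePowerOp S D ω α G₀ (WithLp.toLp 2 (x, y))⟫_ℂ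
      = ((-(1 / 2) * ((Complex.I / (ω : ℂ)) * ⟪x, G₀ S S x + G₀ S D y⟫_ℂ).re
          + α * ‖x‖ ^ 2 : ℝ) : ℂ) := by
  have hω' : (ω : ℂ) ≠ 0 := by exact_mod_cast hω.ne'
  rw [drivePowerOp, inner_blockOp]
  simp only [add_apply, smul_apply, one_apply_eq_self, inner_add_right, inner_smul_right,
    inner_asym, zero_apply, inner_zero_right, ContinuousLinearMap.adjoint_inner_right]
  rw [inner_self_eq_norm_sq_to_K, ← inner_conj_symm (G₀ S D y) x]
  generalize ⟪x, G₀ S S x⟫_ℂ = u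
  generalize ⟪x, G₀ S D y⟫_ℂ = v
  have h1 : ∀ w : ℂ, ((Complex.I / (ω : ℂ)) * w).re = -(w.im / ω) := by
    intro w
    rw [div_mul_eq_mul_div, Complex.div_ofReal_re, Complex.I_mul_re, neg_div]
  have h2 := Complex.sub_conj v
  rw [h1, Complex.add_im]
  push_cast at h2 ⊢
  -- The two off-diagonal blocks are mutually adjoint and together contribute the imaginary part of
  -- the cross term.
  have h3 : (1 / (2 * Complex.I)) * (v - (starRingEnd ℂ) v) = v.im := by
    rw [h2]
    field_simp [Complex.I_ne_zero]
  have h4 : (-1 / (2 * Complex.I) : ℂ) = -(1 / (2 * Complex.I)) := neg_div _ _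
  simp only [Complex.coe_algebraMap]
  rw [h4]
  linear_combination (1 / (2 * (ω : ℂ))) * h3

/-- Energy conservation on every sub-region. -/
theorem inner_energyOp (P : ℝ) {χ : ℂ} (G₀ : BlockOperators) {B : Set Space3}
    (hB : MeasurableSet B) (x : FieldSpace S) (y : FieldSpace D) :
    ⟪(WithLp.toLp 2 (x, y) : JointSpace S D), energyOp S D P χ G₀ B hB (WithLp.toLp 2 (x, y))⟫_ℂ
      = P * ⟪χ⁻¹ • y - (G₀ D S x + G₀ D D y), regionProj D B hB y⟫_ℂ := by
  rw [energyOp, smul_apply, inner_smul_right, inner_blockOp]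
  simp only [zero_apply, inner_zero_right, neg_apply, ContinuousLinearMap.comp_apply, opU,
    sub_apply, smul_apply, one_apply_eq_self, inner_neg_right, inner_sub_right, inner_smul_right,
    ContinuousLinearMap.adjoint_inner_right, inner_sub_left, inner_add_left, inner_smul_left]
  ring

/-- Pointwise, P_ε f - f lies in the kernel of the projection and P_ε f in its range. The
orthogonality is local, so it survives multiplication by any indicator. -/
theorem inner_regionProj_polarization (M : PhotonicStructure D) {χ : ℂ} (hχ : χ ≠ 0)
    (f : FieldSpace D) {B : Set Space3} (hB : MeasurableSet B) :
    ⟪χ⁻¹ • (χ • M.projMul _ f) - f, regionProj D B hB (χ • M.projMul _ f)⟫_ℂ = 0 := by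
  rw [inv_smul_smul₀ hχ, map_smul, inner_smul_right, L2.inner_def]
  refine mul_eq_zero_of_right _ (integral_eq_zero_of_ae ?_)
  filter_upwards [regionMul_coeFn D B hB (M.projMul _ f), M.projMul_coeFn _ f,
    Lp.coeFn_sub (M.projMul _ f) f] with r h1 h2 h3
  change ⟪_, (regionMul D B hB (M.projMul _ f) : Space3 → Amplitude) r⟫_ℂ = 0
  rw [h1, h3, Pi.sub_apply]
  by_cases hr : r ∈ B
  · rw [Set.indicator_of_mem hr, h2]
    have hp := M.isStarProjection_proj r
    have h4 : ContinuousLinearMap.adjoint (M.proj r) = M.proj r := hp.isSelfAdjoint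
    have h5 : M.proj r * M.proj r = M.proj r := hp.isIdempotentElem
    rw [← h4, ContinuousLinearMap.adjoint_inner_right, h4, map_sub, ← mul_apply_eq_comp, h5,
      sub_self, inner_zero_left]
  · rw [Set.indicator_of_notMem hr, inner_zero_right]

/-! ## From a random current to a feasible point of the program -/

section Feasible

variable {S D : Set Space3}

/-- The joint source and polarization currents of a structure, divided by the square root of the
power budget. -/
def jointCurrent (T : FieldSpace S →L[ℂ] FieldSpace D) (P : ℝ) :
    FieldSpace S →L[ℂ] JointSpace S D :=
  (((Real.sqrt P)⁻¹ : ℝ) : ℂ) •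
    ((WithLp.prodContinuousLinearEquiv 2 ℂ (FieldSpace S) (FieldSpace D)).symm :
      FieldSpace S × FieldSpace D →L[ℂ] JointSpace S D).comp
        ((ContinuousLinearMap.id ℂ (FieldSpace S)).prod T)

theorem jointCurrent_apply (T : FieldSpace S →L[ℂ] FieldSpace D) (P : ℝ) (j : FieldSpace S) :
    jointCurrent T P j = (((Real.sqrt P)⁻¹ : ℝ) : ℂ) • WithLp.toLp 2 (j, T j) := rfl

theorem inner_jointCurrent {P : ℝ} (hP : 0 < P) (T : FieldSpace S →L[ℂ] FieldSpace D)
    (A : JointSpace S D →L[ℂ] JointSpace S D) (j : FieldSpace S) :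
    ⟪jointCurrent T P j, A (jointCurrent T P j)⟫_ℂ
      = (P : ℂ)⁻¹ * ⟪(WithLp.toLp 2 (j, T j) : JointSpace S D), A (WithLp.toLp 2 (j, T j))⟫_ℂ := by
  have h : (((Real.sqrt P)⁻¹ : ℝ) : ℂ) * (((Real.sqrt P)⁻¹ : ℝ) : ℂ) = (P : ℂ)⁻¹ := by
    rw [← Complex.ofReal_mul, ← mul_inv, Real.mul_self_sqrt hP.le, Complex.ofReal_inv]
  rw [jointCurrent_apply, map_smul, inner_smul_left, inner_smul_right, Complex.conj_ofReal,
    ← mul_assoc, h]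

variable {γ : Measure (FieldSpace S)}

theorem memLp_of_integrable_norm_sq (hγ : Integrable (fun j => ‖j‖ ^ 2) γ) {E : Type*}
    [NormedAddCommGroup E] [NormedSpace ℂ E] (A : FieldSpace S →L[ℂ] E) :
    MemLp (fun j => A j) 2 γ := by
  have := FieldSpace.secondCountableTopology S
  exact A.comp_memLp'
    ((memLp_two_iff_integrable_sq_norm continuous_id.aestronglyMeasurable).2 hγ)

/-- Each trace is the expectation of a quadratic form in (j, T j). The field identity on S turns the
drive-power form into the power in the structure, and the one on D turns the energy form into the
pointwise orthogonality. -/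
theorem isFeasible_secondMoment {ω α P : ℝ} (hω : 0 < ω) (hP : 0 < P) {χ : ℂ} (hχ : χ ≠ 0)
    {G₀ Gt : BlockOperators} (M : PhotonicStructure D) {κ : Type*} (Dk : κ → Set Space3)
    (hDk : ∀ k, MeasurableSet (Dk k))
    (hGS : ∀ j, Gt S S j = G₀ S S j + G₀ S D (M.polarization χ Gt j))
    (hGD : ∀ j : FieldSpace S, Gt D S j = G₀ D S j + G₀ D D (M.polarization χ Gt j))
    (hγ : Integrable (fun j => ‖j‖ ^ 2) γ) (hpow : expectedDrivePower ω α (Gt S S) γ ≤ P) :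
    IsFeasible S D ω α P χ G₀ Dk hDk
      (secondMoment γ (jointCurrent (M.polarization χ Gt) P)) := by
  have := JointSpace.separableSpace S D
  have hψ := memLp_of_integrable_norm_sq hγ (jointCurrent (M.polarization χ Gt) P)
  have htr := hasTrace_comp_secondMoment hψ
  refine ⟨secondMoment_isPositive hψ, ⟨_, htr 1⟩, ?_, fun k => ?_⟩
  · refine ⟨P⁻¹ * expectedDrivePower ω α (Gt S S) γ, ?_, ?_⟩
    · convert htr (drivePowerOp S D ω α G₀) using 1
      simp_rw [inner_jointCurrent hP, inner_drivePowerOp hω, ← hGS]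
      rw [integral_const_mul, integral_complex_ofReal, integral_add, expectedDrivePower]
      · push_cast; rfl
      · have hid := memLp_of_integrable_norm_sq hγ (ContinuousLinearMap.id ℂ (FieldSpace S))
        have hG := memLp_of_integrable_norm_sq hγ (Gt S S)
        have hin : Integrable (fun j => ⟪j, Gt S S j⟫_ℂ) γ := by
          refine ((hγ.const_mul ‖Gt S S‖)).mono' (hid.1.inner hG.1) (.of_forall fun j => ?_)
          calc _ ≤ ‖j‖ * ‖Gt S S j‖ := norm_inner_le_norm _ _
            _ ≤ ‖j‖ * (‖Gt S S‖ * ‖j‖) := by gcongr; exact (Gt S S).le_opNorm j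
            _ = _ := by ring
        exact ((hin.const_mul _).re).const_mul _
      · exact hγ.const_mul α
    · rw [inv_mul_le_iff₀ hP, mul_one]
      exact hpow
  · convert htr (energyOp S D P χ G₀ (Dk k) (hDk k)) using 1
    simp_rw [inner_jointCurrent hP, inner_energyOp, ← hGD]
    have h0 : ∀ j : FieldSpace S, ⟪χ⁻¹ • M.polarization χ Gt j - Gt D S j,
        regionProj D (Dk k) (hDk k) (M.polarization χ Gt j)⟫_ℂ = 0 := fun j =>
      inner_regionProj_polarization M hχ (Gt D S j) (hDk k)
    simp [h0]

/-- The prefactor P / (N ω²) absorbs the 1 / P of the normalized currents and leaves |i/ω|² / N, so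
the entries are those of the matrix in `mutualInfo_le`. -/
theorem inner_output_secondMoment {R : Set Space3} {ω P N : ℝ} (hω : 0 < ω) (hP : 0 < P)
    (hN : 0 < N) {G₀ Gt : BlockOperators} (T : FieldSpace S →L[ℂ] FieldSpace D)
    (hGR : ∀ j, Gt R S j = G₀ R S j + G₀ R D (T j))
    (hγ : Integrable (fun j => ‖j‖ ^ 2) γ) (v w : FieldSpace R) :
    ⟪v, (((P / (N * ω ^ 2) : ℝ) : ℂ) • ((rowOp (G₀ R S) (G₀ R D)).comp
        ((secondMoment γ (jointCurrent T P)).comp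
          (ContinuousLinearMap.adjoint (rowOp (G₀ R S) (G₀ R D)))))) w⟫_ℂ
      = (N : ℂ)⁻¹ * ∫ j, ⟪v, (Complex.I / (ω : ℂ)) • Gt R S j⟫_ℂ
          * (starRingEnd ℂ) ⟪w, (Complex.I / (ω : ℂ)) • Gt R S j⟫_ℂ ∂γ := by
  have hψ := memLp_of_integrable_norm_sq hγ (jointCurrent T P)
  have hrow : ∀ j, rowOp (G₀ R S) (G₀ R D) (jointCurrent T P j)
      = (((Real.sqrt P)⁻¹ : ℝ) : ℂ) • Gt R S j := fun j => by
    rw [jointCurrent_apply, map_smul, rowOp_toLp, hGR]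
  have hω' : (ω : ℂ) ≠ 0 := by exact_mod_cast hω.ne'
  have hN' : (N : ℂ) ≠ 0 := by exact_mod_cast hN.ne'
  have hP' : (P : ℂ) ≠ 0 := by exact_mod_cast hP.ne'
  have h : (((Real.sqrt P)⁻¹ : ℝ) : ℂ) * (((Real.sqrt P)⁻¹ : ℝ) : ℂ) = (P : ℂ)⁻¹ := by
    rw [← Complex.ofReal_mul, ← mul_inv, Real.mul_self_sqrt hP.le, Complex.ofReal_inv]
  rw [smul_apply, inner_smul_right, ContinuousLinearMap.comp_apply,
    ContinuousLinearMap.comp_apply, ← ContinuousLinearMap.adjoint_inner_left,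
    inner_secondMoment hψ, ← integral_const_mul, ← integral_const_mul]
  refine integral_congr_ae (.of_forall fun j => ?_)
  simp only [ContinuousLinearMap.adjoint_inner_left, ContinuousLinearMap.adjoint_inner_right, hrow,
    inner_smul_right, inner_smul_left, inner_conj_symm, map_mul, map_div₀, Complex.conj_I,
    Complex.conj_ofReal]
  generalize ⟪v, Gt R S j⟫_ℂ = a
  generalize ⟪Gt R S j, w⟫_ℂ = b
  push_cast at h ⊢
  calc _ = (P : ℂ) / (N * ω ^ 2) * (((Real.sqrt P : ℂ)⁻¹ * (Real.sqrt P : ℂ)⁻¹) * (a * b)) := by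
        ring
    _ = (N : ℂ)⁻¹ * (ω : ℂ)⁻¹ ^ 2 * (a * b) := by
        rw [h]
        field_simp
    _ = _ := by
        linear_combination (N : ℂ)⁻¹ * (ω : ℂ)⁻¹ ^ 2 * (a * b) * Complex.I_sq

end Feasible

end

/-! ### The capacity bound -/

theorem mainTheorem1
    (S R D : Set Space3)
    (hS : MeasurableSet S) (hSb : Bornology.IsBounded S)
    (hR : MeasurableSet R) (hRb : Bornology.IsBounded R)
    (hD : MeasurableSet D) (hDb : Bornology.IsBounded D)
    (ω α P N : ℝ) (hω : 0 < ω) (hα : 0 < α) (hP : 0 < P) (hN : 0 < N)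
    (χ : ℂ) (hχ : χ ≠ 0)
    (G₀ : BlockOperators) (hG₀ : IsGreenFunction ω vacuum G₀)
    {κ : Type*} (Dk : κ → Set Space3) (hDk : ∀ k, MeasurableSet (Dk k)) (hDkD : ∀ k, Dk k ⊆ D)
    (M : PhotonicStructure D)
    (Gt : BlockOperators) (hGt : IsGreenFunction ω (M.permittivity χ) Gt) :
    shannonCapacity S R ω α P N Gt ≤ convexBound S R D ω α P N χ G₀ Dk hDk := by
  have hG : ∀ {B : Set Space3}, MeasurableSet B → Bornology.IsBounded B → ∀ j : FieldSpace S,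
      Gt B S j = G₀ B S j + G₀ B D (M.polarization χ Gt j) := fun hB hBb j =>
    M.greenFunction_eq hS hSb hD hDb hω χ hG₀ hGt hB hBb j
  refine iSup_le fun γ => iSup_le fun _ => iSup_le fun hγ => iSup_le fun hpow => ?_
  refine le_iSup₂_of_le _ (isFeasible_secondMoment hω hP hχ M Dk hDk (hG hS hSb) (hG hD hDb)
    hγ hpow) ?_
  refine iSup_le fun m => iSup_le fun u => iSup_le fun hu => ?_
  -- Received field and determinant are compared in the same orthonormal system, so the claim
  -- becomes a finite-dimensional inequality.
  refine le_iSup_of_le m (le_iSup₂_of_le u hu (EReal.coe_le_coe_iff.2 ?_))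
  simp_rw [inner_output_secondMoment hω hP hN (M.polarization χ Gt) (hG hR hRb) hγ]
  refine mutualInfo_le hN (measurable_pi_lambda _ fun k => Continuous.measurable ?_) fun k => ?_
  · exact continuous_const.inner ((Complex.I / (ω : ℂ)) • Gt R S).continuous
  · exact memLp_of_integrable_norm_sq hγ
      ((innerSL ℂ (u k)).comp ((Complex.I / (ω : ℂ)) • Gt R S))
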